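/- Let $k$ be a field with algebraic closure $\bar k$, let $F\in k[X_0,X_1,X_2]$ be a homogeneous polynomial of degree $f$ that is irreducible over $k$, and let $C=V(F)\subset\mathbb P^2_{\bar k}$ be the plane curve it defines over $\bar k$. A singular point of $C$ is a point of $\mathbb P^2(\bar k)$ at which $F$ and its three partial derivatives vanish; it is a $k$-singularity if it lies in $\mathbb P^2(k)$. For a singular point $P$ let $\delta(P)$ be the length of $\widetilde{\mathcal O}_{C,P}/\mathcal O_{C,P}$, where $\widetilde{\mathcal O}_{C,P}$ is the integral closure of $\mathcal O_{C,P}$ in its total ring of fractions. A $k$-singularity $P$ is called admissible if, in some (possibly formal) local coordinates $x,y$ over $k$ centred at $P$, the curve has a local equation $\phi=\sum_i \phi_i$ ($\phi_i$ homogeneous of degree $i$) of one of the following two types: (1) ($R_m$) for some $m\ge 2$, $\phi_i=0$ for $0\le i\le m-1$, and $\phi_m$ is a product of $m$ pairwise non-proportional linear forms over $\bar k$; (2) ($D_m$) for some $m$, $\phi_0=\phi_1=0$, and $\phi_2=L^2$ for a nonzero linear form $L$ over $k$ such that $L^2\mid \phi_i$ for $2\le i\le m-1$ and $L\nmid \phi_m$.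 We say that $(f,g)$ is a case of interest if $f\le 7$ and $g\ge 4$, or $f=8$ and $g\ge 7$, or $f=9$ and $g\ge 11$. (a) Let $g=\binom{f-1}{2}-\sum_P\delta(P)$, the sum being over all singular points $P$ of $C$. If $(f,g)$ is a case of interest and $V(F)$ has only admissible singularities (that is, every singular point of $C$ is a $k$-singularity and is admissible), then the normalization of $C$ is connected. (b) Let $g=\binom{f-1}{2}-\sum_P\delta(P)$, the sum being over the $k$-singularities $P$ only. If $(f,g)$ is a case of interest and all $k$-singularities of $V(F)$ are admissible ($C$ may have further singular points that are not defined over $k$), then the partial normalization of $C$ at the $k$-singularities (the curve obtained by replacing $\mathcal O_{C,P}$ with $\widetilde{\mathcal O}_{C,P}$ for each $k$-singularity $P$, and changing nothing elsewhere) is connected. (In both parts $g$ is a finite number, i.e. $\sum_P\delta(P)$ is assumed to be finite; this is automatic when $C$ is reduced, for instance when $k$ is perfect.) -/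

import Mathlib

open CategoryTheory CategoryTheory.Limits AlgebraicGeometry

universe u

noncomputable section

/-! ### Total and partial normalization of a scheme, and the delta invariant -/

namespace SchemeNormalization

/-- The disjoint union of the spectra of the residue fields at the generic points of the
irreducible components of `X`. -/
def genericScheme (X : Scheme.{u}) : Scheme.{u} :=
  ∐ fun x : genericPoints X => Spec (X.residueField x.1)

/-- The canonical morphism from the generic points of `X` to `X`. -/
def genericScheme.ι (X : Scheme.{u}) : genericScheme X ⟶ X :=
  Sigma.desc fun x : genericPoints X => X.fromSpecResidueField x.1

instance (X : Scheme.{u}) [IsNoetherian X] : CompactSpace (genericScheme X) := by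
  have : Finite (irreducibleComponents X) :=
    TopologicalSpace.NoetherianSpace.finite_irreducibleComponents
  have : Finite (genericPoints X) :=
    Finite.of_injective _ (genericPoints.component_injective (α := X))
  unfold genericScheme
  infer_instance

instance (X : Scheme.{u}) [IsNoetherian X] : QuasiSeparatedSpace (genericScheme X) := by
  have : Finite (irreducibleComponents X) :=
    TopologicalSpace.NoetherianSpace.finite_irreducibleComponents
  have : Finite (genericPoints X) :=
    Finite.of_injective _ (genericPoints.component_injective (α := X))
  unfold genericScheme
  infer_instance

/-- The normalization of a Noetherian scheme: the relative normalization of `X` in the disjoint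
union of the spectra of the residue fields at the generic points of its irreducible components. -/
def normalization (X : Scheme.{u}) [IsNoetherian X] : Scheme.{u} :=
  (genericScheme.ι X).normalization

/-- The complement of (the closure of) a set of points. -/
def complOpen (X : Scheme.{u}) (S : Set X) : X.Opens :=
  ⟨(closure S)ᶜ, isClosed_closure.isOpen_compl⟩

/-- The partial normalization of `X` at `S`: the relative normalization of `X` in `X ∖ S`.
When `X` is a reduced curve and `S` is a finite set of closed points, its ring over an affine
open `V` consists of the functions on `V ∖ S` that are integral over `𝒪(V)`; so the local ring at
a point of `S` is replaced by its integral closure in its total ring of fractions, and nothing is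
changed away from `S`. -/
def partialNormalization (X : Scheme.{u}) [IsNoetherian X] (S : Set X) : Scheme.{u} :=
  (complOpen X S).ι.normalization

/-- The delta invariant of a point `x` of `X`: the length, over the local ring `A` at `x`, of
`A' / A`, where `A'` is the integral closure of `A` in its total ring of fractions. -/
def delta (X : Scheme.{u}) (x : X) : ℕ∞ :=
  let A := X.presheaf.stalk x
  Module.length A
    (integralClosure A (FractionRing A) ⧸
      LinearMap.range (Algebra.linearMap A (integralClosure A (FractionRing A))))

/-- The sum of the delta invariants over a set of points (the supremum of the finite
subsums, in `ℕ∞`). -/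
def totalDelta (X : Scheme.{u}) (S : Set X) : ℕ∞ :=
  ⨆ (T : Finset X) (_ : (T : Set X) ⊆ S), ∑ x ∈ T, delta X x

end SchemeNormalization

/-! ### The plane curve `V(F)` as a scheme -/

namespace PlaneCurve

open MvPolynomial

variable {K : Type u} [Field K]

/-- The homogeneous coordinate ring `K[X₀, X₁, X₂] / (F)`. -/
abbrev CoordRing (F : MvPolynomial (Fin 3) K) : Type u :=
  MvPolynomial (Fin 3) K ⧸ Ideal.span {F}

/-- The degree `n` part of the homogeneous coordinate ring: the classes of the homogeneous
polynomials of degree `n`. -/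
def grading (F : MvPolynomial (Fin 3) K) (n : ℕ) : Submodule K (CoordRing F) :=
  (homogeneousSubmodule (Fin 3) K n).map (Ideal.Quotient.mkₐ K (Ideal.span {F})).toLinearMap

instance (F : MvPolynomial (Fin 3) K) : SetLike.GradedMonoid (grading F) where
  one_mem := ⟨1, isHomogeneous_one _ _, map_one (Ideal.Quotient.mkₐ K (Ideal.span {F}))⟩
  mul_mem := by
    rintro i j _ _ ⟨a, ha, rfl⟩ ⟨b, hb, rfl⟩
    exact ⟨a * b, IsHomogeneous.mul ha hb, map_mul (Ideal.Quotient.mkₐ K (Ideal.span {F})) a b⟩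

attribute [local instance] MvPolynomial.gradedAlgebra

/-- The map taking a polynomial to the family of the classes of its homogeneous parts. -/
def decomposePoly (F : MvPolynomial (Fin 3) K) :
    MvPolynomial (Fin 3) K →ₗ[K] DirectSum ℕ fun n => grading F n :=
  (DirectSum.lmap fun n =>
    ((Ideal.Quotient.mkₐ K (Ideal.span {F})).toLinearMap.submoduleMap
      (homogeneousSubmodule (Fin 3) K n))) ∘ₗ
  (DirectSum.decomposeLinearEquiv (homogeneousSubmodule (Fin 3) K)).toLinearMap

theorem decomposePoly_apply (F p : MvPolynomial (Fin 3) K) (n : ℕ) :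
    (decomposePoly F p n : CoordRing F) =
      Ideal.Quotient.mk (Ideal.span {F})
        (DirectSum.decompose (homogeneousSubmodule (Fin 3) K) p n : MvPolynomial (Fin 3) K) :=
  rfl

theorem decomposePoly_eq_of_mk_eq {F : MvPolynomial (Fin 3) K} {d : ℕ} (hF : F.IsHomogeneous d)
    {p q : MvPolynomial (Fin 3) K}
    (h : Ideal.Quotient.mk (Ideal.span {F}) p = Ideal.Quotient.mk (Ideal.span {F}) q) :
    decomposePoly F p = decomposePoly F q := by
  have hI : (Ideal.span {F}).IsHomogeneous (homogeneousSubmodule (Fin 3) K) :=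
    Ideal.homogeneous_span _ _ (by rintro x rfl; exact ⟨d, hF⟩)
  refine DFinsupp.ext fun n => Subtype.ext ?_
  have := hI n (Ideal.Quotient.eq.mp h)
  rw [DirectSum.decompose_sub] at this
  exact Ideal.Quotient.eq.mpr this

theorem decomposePoly_of_isHomogeneous {F a : MvPolynomial (Fin 3) K} {n : ℕ}
    (ha : a ∈ homogeneousSubmodule (Fin 3) K n) :
    decomposePoly F a = DirectSum.of (fun n => grading F n) n
      ⟨Ideal.Quotient.mk (Ideal.span {F}) a, a, ha, rfl⟩ := by
  refine DFinsupp.ext fun m => Subtype.ext ?_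
  rw [decomposePoly_apply, DirectSum.decompose_of_mem _ ha]
  by_cases h : n = m
  · subst h
    simp only [DirectSum.of_eq_same]
  · rw [DirectSum.of_eq_of_ne _ _ _ (Ne.symm h), DirectSum.of_eq_of_ne _ _ _ (Ne.symm h)]
    simp

theorem coe_decomposePoly (F p : MvPolynomial (Fin 3) K) :
    DirectSum.coeAddMonoidHom (grading F) (decomposePoly F p) =
      Ideal.Quotient.mk (Ideal.span {F}) p := by
  induction p using DirectSum.Decomposition.inductionOn (homogeneousSubmodule (Fin 3) K) with
  | zero => simp
  | add a b ha hb => rw [map_add, map_add, map_add, ha, hb]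
  | homogeneous a =>
    rw [decomposePoly_of_isHomogeneous a.2, DirectSum.coeAddMonoidHom_of]

theorem decomposePoly_eq {F : MvPolynomial (Fin 3) K} {d : ℕ} (hF : F.IsHomogeneous d)
    (x : DirectSum ℕ fun n => grading F n) (p : MvPolynomial (Fin 3) K)
    (h : Ideal.Quotient.mk (Ideal.span {F}) p = DirectSum.coeAddMonoidHom (grading F) x) :
    decomposePoly F p = x := by
  induction x using DirectSum.induction_on generalizing p with
  | zero =>
    rw [decomposePoly_eq_of_mk_eq hF (q := 0) (by simpa using h), map_zero]
  | of n x =>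
    obtain ⟨_, a, ha, rfl⟩ := x
    rw [DirectSum.coeAddMonoidHom_of] at h
    rw [decomposePoly_eq_of_mk_eq hF (q := a) h, decomposePoly_of_isHomogeneous ha]
    rfl
  | add x y hx hy =>
    obtain ⟨a, ha⟩ := Ideal.Quotient.mk_surjective (DirectSum.coeAddMonoidHom (grading F) x)
    obtain ⟨b, hb⟩ := Ideal.Quotient.mk_surjective (DirectSum.coeAddMonoidHom (grading F) y)
    rw [decomposePoly_eq_of_mk_eq hF (q := a + b) (by rw [h, map_add, map_add, ha, hb]), map_add,
      hx a ha, hy b hb]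

/-- The coordinate ring is graded because `F` is homogeneous. -/
@[reducible]
def gradedAlgebra {F : MvPolynomial (Fin 3) K} {d : ℕ} (hF : F.IsHomogeneous d) :
    GradedAlgebra (grading F) where
  decompose' x := decomposePoly F (Function.surjInv Ideal.Quotient.mk_surjective x)
  left_inv x := by
    rw [coe_decomposePoly]
    exact Function.surjInv_eq _ x
  right_inv x := decomposePoly_eq hF x _ (Function.surjInv_eq _ _)

/-- The plane curve `V(F) ⊆ ℙ²` of a homogeneous polynomial `F`, as the scheme
`Proj K[X₀, X₁, X₂] / (F)`. -/
def curve {F : MvPolynomial (Fin 3) K} {d : ℕ} (hF : F.IsHomogeneous d) : Scheme.{u} :=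
  letI := gradedAlgebra hF
  Proj (grading F)

instance {F : MvPolynomial (Fin 3) K} {d : ℕ} (hF : F.IsHomogeneous d) :
    IsNoetherian (curve hF) := by
  let _ := gradedAlgebra hF
  have hsurj : Function.Surjective (algebraMap K (grading F 0)) := by
    rintro ⟨_, a, ha, rfl⟩
    obtain ⟨c, rfl⟩ : ∃ c, a = C c :=
      ⟨_, totalDegree_eq_zero_iff_eq_C.mp (Nat.le_zero.mp (IsHomogeneous.totalDegree_le ha))⟩
    exact ⟨c, rfl⟩
  have : IsNoetherianRing (grading F 0) := isNoetherianRing_of_surjective K _ _ hsurj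
  have : Algebra.FiniteType (grading F 0) (CoordRing F) :=
    have : IsScalarTower K (grading F 0) (CoordRing F) :=
      ⟨fun c x y => by
        change ((c • x : grading F 0) : CoordRing F) * y = c • ((x : CoordRing F) * y)
        rw [Submodule.coe_smul, smul_mul_assoc]⟩
    Algebra.FiniteType.of_restrictScalars_finiteType K _ _
  have : IsLocallyNoetherian (Proj (grading F)) :=
    LocallyOfFiniteType.isLocallyNoetherian (Proj.toSpecZero (grading F))
  have : CompactSpace (Proj (grading F)) :=
    QuasiCompact.compactSpace_of_compactSpace (Proj.toSpecZero (grading F))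
  have : IsNoetherian (Proj (grading F)) := { }
  exact this

/-- `x` is the point of `V(F)` with homogeneous coordinates `v`: a homogeneous polynomial belongs
to the homogeneous prime ideal `x` exactly when it vanishes at `v`. -/
def IsPointAt {F : MvPolynomial (Fin 3) K} {d : ℕ} (hF : F.IsHomogeneous d)
    (x : curve hF) (v : Fin 3 → K) : Prop :=
  letI := gradedAlgebra hF
  letI y : ProjectiveSpectrum (grading F) := x
  ∀ (n : ℕ) (G : MvPolynomial (Fin 3) K), G.IsHomogeneous n →
    (Ideal.Quotient.mk (Ideal.span {F}) G ∈ y.asHomogeneousIdeal ↔ eval v G = 0)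

/-- `v` is a vector of homogeneous coordinates of a singular point of `V(F)`: the polynomial `F`
and its three partial derivatives vanish there. -/
def IsSingularAt (F : MvPolynomial (Fin 3) K) (v : Fin 3 → K) : Prop :=
  v ≠ 0 ∧ eval v F = 0 ∧ ∀ i, eval v (pderiv i F) = 0

end PlaneCurve

/-! ### Plane curves over `k`, their singularities over `k`, and admissibility -/

namespace PlaneCurve

open MvPolynomial

variable {k : Type u} [Field k]

/-- The base change of `F` to the algebraic closure. -/
abbrev geom (F : MvPolynomial (Fin 3) k) : MvPolynomial (Fin 3) (AlgebraicClosure k) :=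
  MvPolynomial.map (algebraMap k (AlgebraicClosure k)) F

/-- The curve `V(F)` over the algebraic closure of `k`. -/
abbrev geomCurve {F : MvPolynomial (Fin 3) k} {f : ℕ} (hF : F.IsHomogeneous f) : Scheme.{u} :=
  curve (F := geom F) (hF.map _)

/-- The set of all singular points of `V(F)` over the algebraic closure. -/
def singularPoints {F : MvPolynomial (Fin 3) k} {f : ℕ} (hF : F.IsHomogeneous f) :
    Set (geomCurve hF) :=
  {x | ∃ v : Fin 3 → AlgebraicClosure k, IsSingularAt (geom F) v ∧ IsPointAt (hF.map _) x v}

/-- The set of the `k`-singularities of `V(F)`: the singular points with coordinates in `k`. -/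
def rationalSingularPoints {F : MvPolynomial (Fin 3) k} {f : ℕ} (hF : F.IsHomogeneous f) :
    Set (geomCurve hF) :=
  {x | ∃ w : Fin 3 → k, IsSingularAt F w ∧
    IsPointAt (hF.map _) x fun i => algebraMap k (AlgebraicClosure k) (w i)}

/-- The polynomial `F(w + x a + y b)` in `x, y`, as a power series. If `w, a, b` is a basis of
`k³`, this is the equation of `V(F)` in affine coordinates `x, y` of the plane that are centred at
the point with homogeneous coordinates `w`. -/
def affineEquation (F : MvPolynomial (Fin 3) k) (w a b : Fin 3 → k) : MvPowerSeries (Fin 2) k :=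
  MvPolynomial.toMvPowerSeries
    (aeval (fun i => C (w i) + C (a i) * X 0 + C (b i) * X 1 : Fin 3 → MvPolynomial (Fin 2) k) F)

/-- `g` is a local equation of `V(F)` in local coordinates `x, y` over `k` in which the point with
homogeneous coordinates `w` is `(0, 0)`. The coordinates may be formal ones, and an equation may be
multiplied by a unit; affine coordinates are the case `u = 1`, `φ = id`. -/
def IsLocalEquation (F : MvPolynomial (Fin 3) k) (w : Fin 3 → k) (g : MvPowerSeries (Fin 2) k) :
    Prop :=
  ∃ a b : Fin 3 → k, LinearIndependent k ![w, a, b] ∧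
    ∃ (u : (MvPowerSeries (Fin 2) k)ˣ)
      (φ : MvPowerSeries (Fin 2) k ≃ₐ[k] MvPowerSeries (Fin 2) k),
      g = u * φ (affineEquation F w a b)

/-- The linear form `a x + b y`. -/
def linearForm {R : Type u} [CommRing R] (a b : R) : MvPowerSeries (Fin 2) R :=
  MvPowerSeries.C a * MvPowerSeries.X 0 + MvPowerSeries.C b * MvPowerSeries.X 1

/-- `g` defines at the origin a regular `m`-fold point (type `R_m`): its homogeneous parts of degree
less than `m` vanish, and the part of degree `m` is a product of `m` pairwise non-proportional
linear forms over the algebraic closure. -/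
def IsRegularPoint (g : MvPowerSeries (Fin 2) k) (m : ℕ) : Prop :=
  (∀ i < m, g.homogeneousComponent i = 0) ∧
    ∃ a b : Fin m → AlgebraicClosure k,
      (∀ i j, i ≠ j → a i * b j - a j * b i ≠ 0) ∧
      MvPowerSeries.map (algebraMap k (AlgebraicClosure k)) (g.homogeneousComponent m) =
        ∏ i, linearForm (a i) (b i)

/-- `g` defines at the origin a double point of index `m` (type `D_m`): `g₀ = g₁ = 0`, and there is
a nonzero linear form `L` over `k` with `g₂ = L²`, with `L² ∣ gᵢ` for `2 ≤ i ≤ m - 1` and with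
`L ∤ gₘ`. (The last condition forces `m ≥ 3`.) -/
def IsDoublePoint (g : MvPowerSeries (Fin 2) k) (m : ℕ) : Prop :=
  g.homogeneousComponent 0 = 0 ∧ g.homogeneousComponent 1 = 0 ∧
    ∃ a b : k, (a ≠ 0 ∨ b ≠ 0) ∧
      g.homogeneousComponent 2 = linearForm a b ^ 2 ∧
      (∀ i, 2 ≤ i → i < m → linearForm a b ^ 2 ∣ g.homogeneousComponent i) ∧
      ¬ linearForm a b ∣ g.homogeneousComponent m

/-- The point of `V(F)` with homogeneous coordinates `w` over `k` is an admissible singularity. -/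
def IsAdmissible (F : MvPolynomial (Fin 3) k) (w : Fin 3 → k) : Prop :=
  ∃ g, IsLocalEquation F w g ∧ ∃ m, 2 ≤ m ∧ (IsRegularPoint g m ∨ IsDoublePoint g m)

/-- All singularities of `V(F)` (over the algebraic closure) are defined over `k` and admissible. -/
def HasOnlyAdmissibleSingularities (F : MvPolynomial (Fin 3) k) : Prop :=
  ∀ v : Fin 3 → AlgebraicClosure k, IsSingularAt (geom F) v →
    ∃ (c : AlgebraicClosure k) (w : Fin 3 → k), c ≠ 0 ∧
      (v = fun i => c * algebraMap k (AlgebraicClosure k) (w i)) ∧ IsAdmissible F w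

/-- All `k`-singularities of `V(F)` are admissible. -/
def HasAdmissibleRationalSingularities (F : MvPolynomial (Fin 3) k) : Prop :=
  ∀ w : Fin 3 → k, IsSingularAt F w → IsAdmissible F w

/-- The cases of interest for the degree `f` and the genus `g`. -/
def CaseOfInterest (f g : ℕ) : Prop :=
  (f ≤ 7 ∧ 4 ≤ g) ∨ (f = 8 ∧ 7 ≤ g) ∨ (f = 9 ∧ 11 ≤ g)

end PlaneCurve

end

/-! ### Homogeneous polynomials -/

/-! Over the algebraic closure the irreducible factors of `F` are permuted transitively, up to
constants, by the automorphisms over `k` (`exists_algEquiv_associated`). Link two factors when they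
share a zero outside a Galois stable set `Z`: the singular points in (a), the `k`-singularities in
(b). The linkage classes are permuted transitively as well, so the `n` classes contribute equal
degrees `e = f / n` to `F`. If `n ≥ 2`, collecting `n / 2` of the classes gives `F = D E` with `D`,
`E` coprime of degrees `a = e (n / 2)` and `b = f - a`, meeting only in `Z`
(`exists_balanced_factorization`).

Where `D` and `E` meet, the integral closure contains the idempotent that separates them, so delta
is at least the local intersection number (`length_quotient_span_pair_le`). A form that lies in `(D,
E)` locally at every common point lies in it globally (`mem_span_pair_of_forall_zero`), and the
forms of degree `a + b` modulo `(D, E)` have dimension `a b` (`finrank_range_combination`). Hence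
the deltas over the points of `Z` add up to at least `a b` (`mul_le_totalDelta`), so that `g + a b`
is at most the binomial coefficient `f - 1` over `2`. The cases of interest exclude this
(`CaseOfInterest.choose_lt`).

So all factors are linked. In (a), non-associated factors meet only in singular points; hence there
is one factor up to constants, the curve is irreducible, and its normalization is connected. In (b),
the complement of the `k`-singularities is connected, and it maps dominantly to the partial
normalization. -/

namespace MvPolynomial

section Semiring

variable {σ R : Type*} [CommRing R]

/-- The ring homomorphism sending `p` to `∑ₙ pₙ Tⁿ`, where `pₙ` is the homogeneous part of `p` of
degree `n`. -/
noncomputable def homogenization : MvPolynomial σ R →ₐ[R] Polynomial (MvPolynomial σ R) :=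
  aeval fun i => Polynomial.C (X i) * Polynomial.X

theorem coeff_homogenization (p : MvPolynomial σ R) (n : ℕ) :
    (homogenization p).coeff n = homogeneousComponent n p := by
  induction p using MvPolynomial.induction_on' with
  | add p q hp hq => rw [map_add, Polynomial.coeff_add, hp, hq, map_add]
  | monomial d a =>
    have h : homogenization (monomial d a) =
        Polynomial.C (monomial d a) * Polynomial.X ^ d.degree := by
      rw [homogenization, aeval_monomial]
      simp only [mul_pow, Finsupp.prod_mul]
      have h1 : (d.prod fun _ k => (Polynomial.X : Polynomial (MvPolynomial σ R)) ^ k) =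
          Polynomial.X ^ d.degree := Finset.prod_pow_eq_pow_sum _ _ _
      rw [h1, monomial_eq, Polynomial.algebraMap_apply, ← mul_assoc, map_mul]
      simp [Finsupp.prod, algebraMap_eq, -prod_X_pow_eq_monomial]
    rw [h, Polynomial.coeff_C_mul_X_pow,
      homogeneousComponent_of_mem ((mem_homogeneousSubmodule _ _).mpr
        (isHomogeneous_monomial a rfl))]

theorem homogenization_of_isHomogeneous {p : MvPolynomial σ R} {n : ℕ} (hp : p.IsHomogeneous n) :
    homogenization p = Polynomial.monomial n p := by
  ext1 m
  rw [coeff_homogenization, homogeneousComponent_of_mem hp, Polynomial.coeff_monomial]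
  simp only [eq_comm]

theorem homogeneousComponent_mul_of_isHomogeneous {p : MvPolynomial σ R} {n : ℕ}
    (hp : p.IsHomogeneous n) (q : MvPolynomial σ R) (m : ℕ) :
    homogeneousComponent (m + n) (p * q) = p * homogeneousComponent m q := by
  rw [← coeff_homogenization, map_mul, homogenization_of_isHomogeneous hp,
    Polynomial.coeff_monomial_mul, coeff_homogenization]

theorem dvd_homogeneousComponent_mul {p : MvPolynomial σ R} {n : ℕ}
    (hp : p.IsHomogeneous n) (q : MvPolynomial σ R) (m : ℕ) :
    p ∣ homogeneousComponent m (p * q) := by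
  rw [← coeff_homogenization, map_mul, homogenization_of_isHomogeneous hp,
    ← Polynomial.C_mul_X_pow_eq_monomial, mul_assoc, Polynomial.coeff_C_mul]
  exact dvd_mul_right _ _

theorem IsHomogeneous.eval_smul {p : MvPolynomial σ R} {n : ℕ} (hp : p.IsHomogeneous n) (c : R)
    (v : σ → R) : eval (c • v) p = c ^ n * eval v p := by
  rw [eval_eq, eval_eq, Finset.mul_sum]
  refine Finset.sum_congr rfl fun d hd => ?_
  simp only [Pi.smul_apply, smul_eq_mul, mul_pow, Finset.prod_mul_distrib,
    Finset.prod_pow_eq_pow_sum]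
  have : ∑ i ∈ d.support, d i = n := by
    by_contra h
    exact (mem_support_iff.mp hd) (hp.coeff_eq_zero h)
  rw [this]
  ring

theorem homogenization_injective :
    Function.Injective (homogenization : MvPolynomial σ R →ₐ[R] _) := by
  rw [injective_iff_map_eq_zero]
  intro p hp
  rw [← sum_homogeneousComponent p]
  refine Finset.sum_eq_zero fun i _ => ?_
  rw [← coeff_homogenization, hp, Polynomial.coeff_zero]

variable [IsDomain R]

/-- A factor of a nonzero homogeneous polynomial is homogeneous. -/
theorem IsHomogeneous.of_dvd {p q : MvPolynomial σ R} {n : ℕ} (hq : q.IsHomogeneous n)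
    (h0 : q ≠ 0) (h : p ∣ q) : p.IsHomogeneous p.totalDegree := by
  obtain ⟨r, rfl⟩ := h
  have hp0 : homogenization p ≠ 0 :=
    (map_ne_zero_iff _ homogenization_injective).mpr (left_ne_zero_of_mul h0)
  have hr0 : homogenization r ≠ 0 :=
    (map_ne_zero_iff _ homogenization_injective).mpr (right_ne_zero_of_mul h0)
  have hm := homogenization_of_isHomogeneous hq
  rw [map_mul] at hm
  -- Degree and trailing degree in `T` are both additive and agree for the product, a monomial in
  -- `T`; hence they agree for each factor.
  have h1 := congrArg Polynomial.natDegree hm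
  have h2 := congrArg Polynomial.natTrailingDegree hm
  rw [Polynomial.natDegree_mul hp0 hr0, Polynomial.natDegree_monomial_eq n h0] at h1
  rw [Polynomial.natTrailingDegree_mul hp0 hr0, Polynomial.natTrailingDegree_monomial h0] at h2
  have h3 := Polynomial.natTrailingDegree_le_natDegree (homogenization p)
  have h4 := Polynomial.natTrailingDegree_le_natDegree (homogenization r)
  have key : p.IsHomogeneous (homogenization p).natDegree := by
    have : p = homogeneousComponent (homogenization p).natDegree p := by
      conv_lhs => rw [← sum_homogeneousComponent p]
      refine Finset.sum_eq_single_of_mem _ ?_ fun b _ hb => ?_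
      · rw [Finset.mem_range, Nat.lt_succ_iff]
        by_contra hlt
        rw [not_le] at hlt
        have := homogeneousComponent_eq_zero _ p hlt
        rw [← coeff_homogenization] at this
        exact hp0 (Polynomial.leadingCoeff_eq_zero.mp this)
      · rw [← coeff_homogenization]
        rcases lt_or_gt_of_ne hb with hb | hb
        · exact Polynomial.coeff_eq_zero_of_lt_natTrailingDegree (by omega)
        · exact Polynomial.coeff_eq_zero_of_natDegree_lt hb
    have h5 := homogeneousComponent_isHomogeneous (homogenization p).natDegree p
    rwa [← this] at h5
  rwa [key.totalDegree (left_ne_zero_of_mul h0)]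

theorem IsHomogeneous.of_mul_left {p q : MvPolynomial σ R} {m n : ℕ} (hp : p.IsHomogeneous m)
    (h0 : p ≠ 0) (h : (p * q).IsHomogeneous (m + n)) : q.IsHomogeneous n := by
  by_cases hq : q = 0
  · rw [hq]; exact isHomogeneous_zero σ R n
  have h1 := h.of_dvd (mul_ne_zero h0 hq) (dvd_mul_left q p)
  have := (hp.mul h1).inj_right h (mul_ne_zero h0 hq)
  rwa [Nat.add_left_cancel this] at h1

theorem IsHomogeneous.not_dvd_of_lt {p q : MvPolynomial σ R} {m n : ℕ} (hp : p.IsHomogeneous m)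
    (hq : q.totalDegree ≤ n) (h0 : q ≠ 0) (h : n < m) : ¬ p ∣ q := by
  rintro ⟨r, rfl⟩
  rw [totalDegree_mul_of_isDomain (left_ne_zero_of_mul h0) (right_ne_zero_of_mul h0),
    hp.totalDegree (left_ne_zero_of_mul h0)] at hq
  omega

end Semiring

theorem finrank_homogeneousSubmodule_fin_three (K : Type*) [Field K] (n : ℕ) :
    Module.finrank K (homogeneousSubmodule (Fin 3) K n) = (n + 2).choose 2 := by
  rw [homogeneousSubmodule_eq_finsupp_supported,
    (AddMonoidAlgebra.supportedEquivFinsupp (R := K) (S := K)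
      {d : Fin 3 →₀ ℕ | d.degree = n}).finrank_eq]
  have hs : {d : Fin 3 →₀ ℕ | d.degree = n} =
      ((Finset.univ : Finset (Fin 3)).finsuppAntidiag n : Set (Fin 3 →₀ ℕ)) := by
    ext d
    simp [Finsupp.degree_eq_sum]
  rw [hs, Module.finrank_finsupp_self]
  simp only [Finset.coe_sort_coe, Fintype.card_coe]
  rw [Finset.card_finsuppAntidiag_nat_eq_choose]
  simp only [Finset.card_univ, Fintype.card_fin]
  rw [show 3 + n - 1 = n + 2 by omega, Nat.choose_symm_add]

instance {K : Type*} [Field K] (n : ℕ) :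
    Module.Finite K (homogeneousSubmodule (Fin 3) K n) :=
  Module.Finite.iff_fg.mpr (homogeneousSubmodule_fg (Fin 3) K n)

end MvPolynomial

/-! ### Plane curves without common component -/

namespace PlaneCurve

open MvPolynomial

section Dimension

variable {K : Type*} [Field K]

/-- The Euler characteristic of the Koszul complex of `D, E` in degree `a + b + M`: the defect `a *
b` is the dimension of the quotient by `(D, E)`. -/
theorem choose_two_add (a b M : ℕ) :
    (a + b + M + 2).choose 2 + (M + 2).choose 2 =
      (b + M + 2).choose 2 + (a + M + 2).choose 2 + a * b := by
  have : ∀ n : ℕ, (((n + 2).choose 2 : ℕ) : ℚ) = (n + 2) * (n + 1) / 2 := fun n => by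
    rw [Nat.cast_choose_two]; push_cast; ring
  have h : (((a + b + M + 2).choose 2 + (M + 2).choose 2 : ℕ) : ℚ) =
      (((b + M + 2).choose 2 + (a + M + 2).choose 2 + a * b : ℕ) : ℚ) := by
    push_cast
    rw [this, this, this, this]
    push_cast
    ring
  exact_mod_cast h

/-- The map `(α, β) ↦ α D + β E` on pairs of homogeneous polynomials. -/
noncomputable def combination (D E : MvPolynomial (Fin 3) K) (m n : ℕ) :
    (homogeneousSubmodule (Fin 3) K m × homogeneousSubmodule (Fin 3) K n) →ₗ[K]
      MvPolynomial (Fin 3) K :=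
  ((LinearMap.mulRight K D).comp (Submodule.subtype _)).coprod
    ((LinearMap.mulRight K E).comp (Submodule.subtype _))

theorem combination_apply (D E : MvPolynomial (Fin 3) K) (m n : ℕ)
    (x : homogeneousSubmodule (Fin 3) K m × homogeneousSubmodule (Fin 3) K n) :
    combination D E m n x = x.1 * D + x.2 * E := rfl

variable {D E : MvPolynomial (Fin 3) K} {a b : ℕ}

theorem range_combination_le (hD : D.IsHomogeneous a) (hE : E.IsHomogeneous b) (M : ℕ) :
    LinearMap.range (combination D E (b + M) (a + M)) ≤
      homogeneousSubmodule (Fin 3) K (a + b + M) := by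
  rintro _ ⟨⟨⟨α, hα⟩, ⟨β, hβ⟩⟩, rfl⟩
  rw [combination_apply]
  refine Submodule.add_mem _ ?_ ?_
  · have := IsHomogeneous.mul hα hD
    rwa [show b + M + a = a + b + M by ring] at this
  · have := IsHomogeneous.mul hβ hE
    rwa [show a + M + b = a + b + M by ring] at this

/-- By coprimality the only syzygies of `D, E` are the Koszul ones `(γ E, -γ D)`, with `γ` of degree
`M`, so the kernel has a known dimension. In degrees at least `a + b` the quotient by `(D, E)`
therefore has dimension exactly `a b`. -/
theorem finrank_range_combination (hD : D.IsHomogeneous a) (hE : E.IsHomogeneous b)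
    (hE0 : E ≠ 0) (h : IsRelPrime D E) (M : ℕ) :
    Module.finrank K (LinearMap.range (combination D E (b + M) (a + M))) + a * b =
      (a + b + M + 2).choose 2 := by
  let κ : homogeneousSubmodule (Fin 3) K M →ₗ[K]
      homogeneousSubmodule (Fin 3) K (b + M) × homogeneousSubmodule (Fin 3) K (a + M) :=
    (((LinearMap.mulRight K E).comp (Submodule.subtype _)).codRestrict _ fun γ => by
      rw [add_comm b]; exact IsHomogeneous.mul γ.2 hE).prod
    (((LinearMap.mulRight K (-D)).comp (Submodule.subtype _)).codRestrict _ fun γ => by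
      rw [add_comm a]; exact IsHomogeneous.mul γ.2 hD.neg)
  have hinj : Function.Injective κ := by
    intro x y hxy
    have := congrArg (fun z => (z.1 : MvPolynomial (Fin 3) K)) hxy
    exact Subtype.ext (mul_right_cancel₀ hE0 this)
  have hker : LinearMap.ker (combination D E (b + M) (a + M)) = LinearMap.range κ := by
    apply le_antisymm
    · rintro ⟨⟨α, hα⟩, ⟨β, hβ⟩⟩ hx
      rw [LinearMap.mem_ker, combination_apply] at hx
      replace hx : α * D + β * E = 0 := hx
      obtain ⟨γ, rfl⟩ : E ∣ α := h.symm.dvd_of_dvd_mul_right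
        ⟨-β, by linear_combination hx⟩
      have hγ : β = -(γ * D) := mul_right_cancel₀ hE0 (by linear_combination hx)
      refine ⟨⟨γ, hE.of_mul_left hE0 hα⟩, ?_⟩
      ext1 <;> ext1
      · exact mul_comm _ _
      · exact (mul_neg γ D).trans hγ.symm
    · rintro _ ⟨γ, rfl⟩
      rw [LinearMap.mem_ker, combination_apply]
      change (γ : MvPolynomial (Fin 3) K) * E * D + γ * -D * E = 0
      ring
  have h1 := LinearMap.finrank_range_add_finrank_ker (combination D E (b + M) (a + M))
  rw [hker, LinearMap.finrank_range_of_inj hinj, Module.finrank_prod,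
    finrank_homogeneousSubmodule_fin_three, finrank_homogeneousSubmodule_fin_three,
    finrank_homogeneousSubmodule_fin_three] at h1
  have := choose_two_add a b M
  omega

/-- The linear form with the given coefficients. -/
noncomputable def linForm (c : Fin 3 → K) : MvPolynomial (Fin 3) K := ∑ i, C (c i) * X i

theorem isHomogeneous_linForm (c : Fin 3 → K) : (linForm c).IsHomogeneous 1 :=
  IsHomogeneous.sum _ _ _ fun _ _ => isHomogeneous_C_mul_X _ _

theorem eval_linForm (c v : Fin 3 → K) : eval v (linForm c) = ∑ i, c i * v i := by
  simp [linForm]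

theorem exists_linForm_ne_zero {v : Fin 3 → K} (hv : v ≠ 0) : ∃ c, eval v (linForm c) ≠ 0 := by
  obtain ⟨i, hi⟩ := Function.ne_iff.mp hv
  exact ⟨Pi.single i 1, by simpa [eval_linForm, Pi.single_apply] using hi⟩

theorem exists_linForm_separating {v w : Fin 3 → K} (hw : w ≠ 0) (h : ∀ c : K, v ≠ c • w) :
    ∃ c, eval w (linForm c) = 0 ∧ eval v (linForm c) ≠ 0 := by
  obtain ⟨s, hs⟩ := Function.ne_iff.mp hw
  have hs : w s ≠ 0 := hs
  obtain ⟨t, ht⟩ := Function.ne_iff.mp (h (v s / w s))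
  -- The form `w_s X_t - w_t X_s` kills `w`; it kills `v` only if `v_t = (v_s / w_s) w_t`, which the
  -- choice of `t` excludes.
  refine ⟨w s • Pi.single t 1 - w t • Pi.single s 1, ?_, ?_⟩
  · simp only [eval_linForm, Pi.sub_apply, Pi.smul_apply, Pi.single_apply, smul_eq_mul, sub_mul,
      Finset.sum_sub_distrib]
    simp [mul_comm]
  · simp only [eval_linForm, Pi.sub_apply, Pi.smul_apply, Pi.single_apply, smul_eq_mul, sub_mul,
      Finset.sum_sub_distrib]
    simp only [mul_ite, mul_one, mul_zero, ite_mul, zero_mul, Finset.sum_ite_eq',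
      Finset.mem_univ, if_true]
    intro h0
    apply ht
    simp only [Pi.smul_apply, smul_eq_mul]
    field_simp
    linear_combination h0

/-- Two plane curves of degrees `a` and `b` without common component have at most `ab` common
points. -/
theorem card_commonZeros_le (hD : D.IsHomogeneous a) (hE : E.IsHomogeneous b)
    (hE0 : E ≠ 0) (h : IsRelPrime D E) {N : ℕ} (w : Fin N → Fin 3 → K) (hw : ∀ i, w i ≠ 0)
    (hsep : ∀ i j, i ≠ j → ∀ c : K, w i ≠ c • w j) (hDw : ∀ i, eval (w i) D = 0)
    (hEw : ∀ i, eval (w i) E = 0) : N ≤ a * b := by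
  let ev : homogeneousSubmodule (Fin 3) K (a + b + N) →ₗ[K] (Fin N → K) :=
    LinearMap.pi fun i => (aeval (w i)).toLinearMap.comp (Submodule.subtype _)
  have hev : ∀ G i, ev G i = eval (w i) (G : MvPolynomial (Fin 3) K) := fun G i => by
    simp [ev, aeval_eq_eval]
  have hsurj : Function.Surjective ev := by
    rw [← LinearMap.range_eq_top, eq_top_iff, ← (Pi.basisFun K (Fin N)).span_eq, Submodule.span_le]
    rintro _ ⟨i, rfl⟩
    have hL : ∀ j, ∃ c, (j ≠ i → eval (w j) (linForm c) = 0) ∧ eval (w i) (linForm c) ≠ 0 := by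
      intro j
      by_cases hij : j = i
      · obtain ⟨c, hc⟩ := exists_linForm_ne_zero (hw i)
        exact ⟨c, fun h => absurd hij h, hc⟩
      · obtain ⟨c, hc, hc'⟩ := exists_linForm_separating (hw j) (hsep i j (Ne.symm hij))
        exact ⟨c, fun _ => hc, hc'⟩
    choose L hL0 hL1 using hL
    -- The product already separates `w i` from the other points; the extra power only pads the
    -- degree to `a + b + N`.
    let G : MvPolynomial (Fin 3) K := linForm (L i) ^ (a + b) * ∏ j, linForm (L j)
    have hG : G.IsHomogeneous (a + b + N) := by
      have h1 := ((isHomogeneous_linForm (L i)).pow (a + b)).mul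
        (IsHomogeneous.prod Finset.univ _ (fun _ => 1) fun j _ => isHomogeneous_linForm (L j))
      simpa using h1
    have hGi : eval (w i) G ≠ 0 := by
      simp only [G, map_mul, map_pow, map_prod]
      exact mul_ne_zero (pow_ne_zero _ (hL1 i)) (Finset.prod_ne_zero_iff.mpr fun j _ => hL1 j)
    refine ⟨(eval (w i) G)⁻¹ • ⟨G, hG⟩, ?_⟩
    ext j
    rw [map_smul, Pi.smul_apply, hev, Pi.basisFun_apply, Pi.single_apply]
    split_ifs with hij
    · subst hij
      exact inv_mul_cancel₀ hGi
    · have : eval (w j) G = 0 := by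
        simp only [G, map_mul, map_pow, map_prod]
        rw [Finset.prod_eq_zero (Finset.mem_univ j) (hL0 j hij), mul_zero]
      simp [this]
  have h1 := LinearMap.finrank_range_add_finrank_ker ev
  rw [LinearMap.range_eq_top.mpr hsurj, finrank_top, Module.finrank_fin_fun,
    finrank_homogeneousSubmodule_fin_three] at h1
  have h2 := finrank_range_combination hD hE hE0 h N
  -- The forms vanishing at the `N` points have codimension `N`, and they contain a space of
  -- codimension `a b`.
  have h3 : LinearMap.range (combination D E (b + N) (a + N)) ≤
      (LinearMap.ker ev).map (Submodule.subtype _) := by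
    intro x hx
    refine ⟨⟨x, range_combination_le hD hE N hx⟩, ?_, rfl⟩
    obtain ⟨y, hy⟩ := hx
    rw [SetLike.mem_coe, LinearMap.mem_ker]
    ext i
    rw [hev, Pi.zero_apply]
    change eval (w i) x = 0
    rw [← hy, combination_apply]
    simp [hDw, hEw]
  have h4 := (Submodule.finrank_mono h3).trans (Submodule.finrank_map_le _ _)
  omega

end Dimension

end PlaneCurve

/-! ### Noether's theorem: from local to global membership in `(D, E)` -/

namespace PlaneCurve

open MvPolynomial

section Saturation

variable {K : Type*} [Field K]

/-- The substitution that eliminates the variable `Xᵢ` by means of the equation `linForm c = 0`. -/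
noncomputable def eliminate (c : Fin 3 → K) (i : Fin 3) :
    MvPolynomial (Fin 3) K →ₐ[K] MvPolynomial (Fin 3) K :=
  aeval fun j => X j - if j = i then C (c i)⁻¹ * linForm c else 0

theorem eliminate_X_of_ne (c : Fin 3 → K) {i j : Fin 3} (h : j ≠ i) :
    eliminate c i (X j) = X j := by
  simp [eliminate, h]

theorem eliminate_linForm (c : Fin 3 → K) {i : Fin 3} (h : c i ≠ 0) :
    eliminate c i (linForm c) = 0 := by
  have h1 : eliminate c i (linForm c) =
      ∑ j, C (c j) * (X j - if j = i then C (c i)⁻¹ * linForm c else 0) := by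
    rw [linForm, map_sum]
    refine Finset.sum_congr rfl fun j _ => ?_
    rw [map_mul, eliminate, aeval_X, aeval_C]
    rfl
  rw [h1]
  simp only [mul_sub, Finset.sum_sub_distrib, mul_ite, mul_zero, Finset.sum_ite_eq',
    Finset.mem_univ, if_true]
  rw [← mul_assoc, ← C_mul, mul_inv_cancel₀ h, C_1, one_mul, linForm, sub_self]

theorem linForm_dvd_sub_eliminate (c : Fin 3 → K) (i : Fin 3) (g : MvPolynomial (Fin 3) K) :
    linForm c ∣ g - eliminate c i g := by
  rw [← Ideal.mem_span_singleton, ← Ideal.Quotient.eq]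
  have : (Ideal.Quotient.mkₐ K (Ideal.span {linForm c})).comp (eliminate c i) =
      Ideal.Quotient.mkₐ K (Ideal.span {linForm c}) := by
    refine algHom_ext fun j => ?_
    rw [AlgHom.comp_apply, eliminate, aeval_X, map_sub]
    split_ifs
    · rw [map_mul, Ideal.Quotient.mkₐ_eq_mk, Ideal.Quotient.mk_singleton_self, mul_zero, sub_zero]
    · rw [map_zero, sub_zero]
  exact (DFunLike.congr_fun this g).symm

variable [IsAlgClosed K] {D E : MvPolynomial (Fin 3) K}

/-- By the Nullstellensatz: the only possible zero is the origin, where every variable vanishes. -/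
theorem X_mem_radical {I : Ideal (MvPolynomial (Fin 3) K)}
    (h : ∀ v : Fin 3 → K, (∀ p ∈ I, eval v p = 0) → v = 0) (i : Fin 3) : X i ∈ I.radical := by
  rw [← vanishingIdeal_zeroLocus_eq_radical (K := K), mem_vanishingIdeal_iff]
  intro v hv
  rw [h v fun p hp => by simpa [aeval_eq_eval] using (mem_zeroLocus_iff.mp hv) p hp]
  simp

/-- A linear form without zeros in common with two plane curves that do not meet on its line is not
a zero divisor modulo the equations of the curves. -/
theorem mem_span_pair_of_linForm_mul_mem (hD : constantCoeff D = 0)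
    {c : Fin 3 → K} (hc : c ≠ 0)
    (h : ∀ v, eval v D = 0 → eval v E = 0 → eval v (linForm c) = 0 → v = 0)
    {G : MvPolynomial (Fin 3) K} (hG : linForm c * G ∈ Ideal.span {D, E}) :
    G ∈ Ideal.span {D, E} := by
  obtain ⟨i, hi⟩ := Function.ne_iff.mp hc
  have hi : c i ≠ 0 := hi
  set θ := eliminate c i with hθ
  have hℓ : linForm c ≠ 0 := by
    obtain ⟨v, hv⟩ := exists_linForm_ne_zero hc
    intro h0
    apply hv
    rw [eval_linForm]
    simp_rw [mul_comm]
    rw [← eval_linForm, h0, map_zero]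
  -- The curves do not meet on the line, so a power of each variable lies in `(D, E, linForm c)`;
  -- eliminating `X i` removes the last generator and fixes the other variables.
  have hpow : ∀ j, j ≠ i → ∃ N α β, (X j : MvPolynomial (Fin 3) K) ^ N = α * θ D + β * θ E := by
    intro j hj
    have : X j ∈ (Ideal.span {D, E, linForm c}).radical := by
      refine X_mem_radical (fun v hv => h v ?_ ?_ ?_) j <;>
        exact hv _ (Ideal.subset_span (by simp))
    obtain ⟨N, hN⟩ := this
    rw [Ideal.mem_span_insert] at hN
    obtain ⟨α, z, hz, hN⟩ := hN
    obtain ⟨β, γ, rfl⟩ := Ideal.mem_span_pair.mp hz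
    refine ⟨N, θ α, θ β, ?_⟩
    have := congrArg θ hN
    rwa [map_pow, hθ, eliminate_X_of_ne c hj, map_add, map_add, map_mul, map_mul, map_mul,
      eliminate_linForm c hi, mul_zero, add_zero] at this
  obtain ⟨j, k, hj, hk, hjk⟩ : ∃ j k : Fin 3, j ≠ i ∧ k ≠ i ∧ j ≠ k := by
    have : ∀ i : Fin 3, ∃ j k : Fin 3, j ≠ i ∧ k ≠ i ∧ j ≠ k := by decide
    exact this i
  -- A common factor divides powers of two different variables.
  have hrel : IsRelPrime (θ D) (θ E) := by
    intro d hd1 hd2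
    obtain ⟨N, α, β, h1⟩ := hpow j hj
    obtain ⟨N', α', β', h2⟩ := hpow k hk
    have h1 : d ∣ X j ^ N := h1 ▸ dvd_add (hd1.mul_left _) (hd2.mul_left _)
    have h2 : d ∣ X k ^ N' := h2 ▸ dvd_add (hd1.mul_left _) (hd2.mul_left _)
    have h3 : IsRelPrime (X j : MvPolynomial (Fin 3) K) (X k) := by
      exact (X_prime (R := K)).irreducible.isRelPrime_iff_not_dvd.mpr fun h => hjk (X_dvd_X.mp h)
    exact (h3.pow (m := N) (n := N')) h1 h2
  have hconst : ∀ p : MvPolynomial (Fin 3) K, constantCoeff (θ p) = constantCoeff p := by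
    intro p
    obtain ⟨q, hq⟩ := linForm_dvd_sub_eliminate c i p
    have := congrArg constantCoeff hq
    rw [map_sub, map_mul, show constantCoeff (linForm c) = 0 by simp [linForm], zero_mul] at this
    exact (sub_eq_zero.mp this).symm
  have hE0 : θ E ≠ 0 := by
    intro h0
    rw [h0, isRelPrime_zero_right] at hrel
    have := hrel.map (constantCoeff (σ := Fin 3) (R := K))
    rw [hconst, hD] at this
    exact not_isUnit_zero this
  obtain ⟨A, B, hAB⟩ := Ideal.mem_span_pair.mp hG
  have h0 : θ A * θ D + θ B * θ E = 0 := by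
    rw [← map_mul, ← map_mul, ← map_add, hAB, map_mul, hθ, eliminate_linForm c hi, zero_mul]
  obtain ⟨T, hT⟩ : θ E ∣ θ A := hrel.symm.dvd_of_dvd_mul_right ⟨-θ B, by linear_combination h0⟩
  have hB : θ B = -(T * θ D) := mul_right_cancel₀ hE0 (by rw [hT] at h0; linear_combination h0)
  obtain ⟨A', hA'⟩ := linForm_dvd_sub_eliminate c i A
  obtain ⟨B', hB'⟩ := linForm_dvd_sub_eliminate c i B
  obtain ⟨D', hD'⟩ := linForm_dvd_sub_eliminate c i D
  obtain ⟨E', hE'⟩ := linForm_dvd_sub_eliminate c i E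
  rw [← hθ] at hA' hB' hD' hE'
  -- Modulo the line, `(A, B)` is the Koszul syzygy `T (E, -D)`. Subtracting it makes both
  -- coefficients divisible by the linear form, which is then cancelled.
  refine Ideal.mem_span_pair.mpr ⟨A' - T * E', B' + T * D', mul_left_cancel₀ hℓ ?_⟩
  linear_combination hAB - D * hA' - E * hB' - D * hT - E * hB + T * D * hE' - T * E * hD'

/-- The colon ideal of `G` contains `(D, E)` and, for each common zero, an element not vanishing
there. By the Nullstellensatz it contains a power of the linear form, whose factors are removed one
at a time because the form is not a zero divisor modulo `(D, E)`. -/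
theorem mem_span_pair_of_forall_zero {a : ℕ} (hD : D.IsHomogeneous a)
    (ha : a ≠ 0) {c : Fin 3 → K} (hc : c ≠ 0)
    (h : ∀ v, eval v D = 0 → eval v E = 0 → eval v (linForm c) = 0 → v = 0)
    {G : MvPolynomial (Fin 3) K}
    (hG : ∀ v ≠ 0, eval v D = 0 → eval v E = 0 →
      ∃ s, eval v s ≠ 0 ∧ s * G ∈ Ideal.span {D, E}) :
    G ∈ Ideal.span {D, E} := by
  have hconst : ∀ {p : MvPolynomial (Fin 3) K} {n : ℕ}, p.IsHomogeneous n → n ≠ 0 →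
      constantCoeff p = 0 := fun hp hn => hp.coeff_eq_zero (by simpa using hn.symm)
  let J : Ideal (MvPolynomial (Fin 3) K) := (Ideal.span {D, E}).colon {G}
  have hJ : ∀ s, s ∈ J ↔ s * G ∈ Ideal.span {D, E} := fun s => by
    simp [J, Submodule.mem_colon_singleton]
  have hle : Ideal.span {D, E} ≤ J := fun s hs => (hJ s).mpr (Ideal.mul_mem_right _ _ hs)
  have hX : ∀ i, X i ∈ J.radical := X_mem_radical fun v hv => by
    by_contra hv0
    obtain ⟨s, hs, hsG⟩ := hG v hv0 (hv D (hle (Ideal.subset_span (by simp))))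
      (hv E (hle (Ideal.subset_span (by simp))))
    exact hs (hv s ((hJ s).mpr hsG))
  obtain ⟨N, hN⟩ : linForm c ∈ J.radical :=
    Ideal.sum_mem _ fun i _ => Ideal.mul_mem_left _ _ (hX i)
  rw [hJ] at hN
  induction N with
  | zero => simpa using hN
  | succ N ih =>
    refine ih (mem_span_pair_of_linForm_mul_mem (hconst hD ha) hc h ?_)
    rwa [← mul_assoc, ← pow_succ']

end Saturation

end PlaneCurve

/-! ### A lower bound for the delta invariant -/

namespace SchemeNormalization

section

variable {A : Type*} [CommRing A] {d e : A}

/-- If `d e = 0`, and `d` and `e` generate each other's annihilator and have no common multiple but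
zero, then `d / (d + e)` is an idempotent of the total ring of fractions, and it generates modulo
the ring a module isomorphic to `A / (d, e)`. -/
theorem length_quotient_span_pair_le (hde : d * e = 0) (hd : ∀ x, d * x = 0 → e ∣ x)
    (he : ∀ x, e * x = 0 → d ∣ x) (hint : ∀ x, d ∣ x → e ∣ x → x = 0) :
    Module.length A (A ⧸ Ideal.span {d, e}) ≤
      Module.length A (integralClosure A (FractionRing A) ⧸
        LinearMap.range (Algebra.linearMap A (integralClosure A (FractionRing A)))) := by
  have hreg : d + e ∈ nonZeroDivisors A := by
    rw [mem_nonZeroDivisors_iff_left]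
    intro x hx
    have h1 : d * x = 0 := hint _ (dvd_mul_right _ _) ⟨-x, by linear_combination hx⟩
    have h2 : e * x = 0 := by linear_combination hx - h1
    exact hint x (he x h2) (hd x h1)
  -- The function that is `0` on `d = 0` and `1` on `e = 0`.
  let ε : FractionRing A := IsLocalization.mk' _ d ⟨d + e, hreg⟩
  have hε : ε * algebraMap A _ (d + e) = algebraMap A _ d := IsLocalization.mk'_spec _ _ _
  have hu : IsUnit (algebraMap A (FractionRing A) (d + e)) :=
    IsLocalization.map_units _ (⟨d + e, hreg⟩ : nonZeroDivisors A)
  have hidem : ε * ε = ε := by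
    apply (hu.mul hu).mul_right_cancel
    have h1 : algebraMap A (FractionRing A) d * algebraMap A _ d =
        algebraMap A _ d * algebraMap A _ (d + e) := by
      rw [← map_mul, ← map_mul, mul_add, hde, add_zero]
    linear_combination (ε * algebraMap A _ (d + e) + algebraMap A _ d) * hε + h1 -
      algebraMap A (FractionRing A) (d + e) * hε
  have hεint : IsIntegral A ε := by
    refine ⟨Polynomial.X ^ 2 - Polynomial.X,
      Polynomial.monic_X_pow_sub (n := 2) (Polynomial.degree_X_le.trans_lt (by norm_num)), ?_⟩
    rw [Polynomial.eval₂_sub, Polynomial.eval₂_X_pow, Polynomial.eval₂_X, pow_two, hidem, sub_self]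
  let ε' : integralClosure A (FractionRing A) := ⟨ε, hεint⟩
  let N := LinearMap.range (Algebra.linearMap A (integralClosure A (FractionRing A)))
  let f : A →ₗ[A] integralClosure A (FractionRing A) ⧸ N :=
    N.mkQ.comp (LinearMap.toSpanSingleton A _ ε')
  -- If `a ε = c` with `c` in the ring, then `c (d + e) = a d`, so `a - c` kills `d` and `c` kills
  -- `e`; thus `a = (a - c) + c` lies in `(d, e)`.
  have hker : LinearMap.ker f ≤ Ideal.span {d, e} := by
    intro a ha
    obtain ⟨c, hc⟩ : a • ε' ∈ N := (Submodule.Quotient.mk_eq_zero _).mp ha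
    have hc : algebraMap A (FractionRing A) c = algebraMap A _ a * ε := by
      have := congrArg Subtype.val hc
      simpa [Algebra.smul_def] using this
    have h1 : c * (d + e) = a * d := by
      apply IsFractionRing.injective A (FractionRing A)
      rw [map_mul, map_mul, hc, ← hε]
      ring
    have h2 : (a - c) * d = 0 :=
      hint _ (dvd_mul_left _ _) ⟨c, by linear_combination -h1⟩
    have h3 : c * e = 0 := by linear_combination h1 + h2
    obtain ⟨y, hy⟩ := hd (a - c) (by rw [mul_comm, h2])
    obtain ⟨z, hz⟩ := he c (by rw [mul_comm, h3])
    exact Ideal.mem_span_pair.mpr ⟨z, y, by linear_combination -hz - hy⟩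
  calc Module.length A (A ⧸ Ideal.span {d, e})
      ≤ Module.length A (A ⧸ LinearMap.ker f) :=
        Module.length_le_of_surjective (Submodule.factor hker) (Submodule.factor_surjective hker)
    _ = Module.length A (LinearMap.range f) := f.quotKerEquivRange.length_eq
    _ ≤ _ := Module.length_le_of_injective _ (Submodule.subtype_injective _)

/-- The field `K` maps onto the residue field, so each simple factor over `A` has length at most one
over `K`. -/
theorem length_le_length_of_residue {K : Type*} [Field K] [IsLocalRing A] [Algebra K A]
    (hres : ∀ x : A, ∃ c : K, x - algebraMap K A c ∈ IsLocalRing.maximalIdeal A)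
    (M : Type*) [AddCommGroup M] [Module A M] [Module K M] [IsScalarTower K A M] :
    Module.length K M ≤ Module.length A M := by
  rw [IsLocalRing.length_restrictScalars K A M]
  have h : Module.length (IsLocalRing.ResidueField K) (IsLocalRing.ResidueField A) ≤ 1 := by
    rw [← Module.length_eq_one (IsLocalRing.ResidueField K) (IsLocalRing.ResidueField K)]
    refine Module.length_le_of_surjective
      (Algebra.linearMap (IsLocalRing.ResidueField K) (IsLocalRing.ResidueField A)) fun x => ?_
    obtain ⟨x, rfl⟩ := IsLocalRing.residue_surjective x
    obtain ⟨c, hc⟩ := hres x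
    refine ⟨IsLocalRing.residue K c, ?_⟩
    rw [← IsLocalRing.residue_eq_zero_iff, map_sub, sub_eq_zero] at hc
    rw [hc]
    rfl
  calc _ ≤ Module.length A M * 1 := by gcongr
    _ = _ := mul_one _

/-- A lower bound for the length of the integral closure modulo the ring by the dimension of a
vector space that maps to the ring. -/
theorem finrank_quotient_le_length {K : Type*} [Field K] [IsLocalRing A] [Algebra K A]
    (hres : ∀ x : A, ∃ c : K, x - algebraMap K A c ∈ IsLocalRing.maximalIdeal A)
    (hde : d * e = 0) (hd : ∀ x, d * x = 0 → e ∣ x)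
    (he : ∀ x, e * x = 0 → d ∣ x) (hint : ∀ x, d ∣ x → e ∣ x → x = 0)
    {W : Type*} [AddCommGroup W] [Module K W] [Module.Finite K W] (φ : W →ₗ[K] A)
    (I : Submodule K W) (hI : ∀ w, φ w ∈ Ideal.span {d, e} → w ∈ I) :
    (Module.finrank K (W ⧸ I) : ℕ∞) ≤
      Module.length A (integralClosure A (FractionRing A) ⧸
        LinearMap.range (Algebra.linearMap A (integralClosure A (FractionRing A)))) := by
  let f : W →ₗ[K] A ⧸ Ideal.span {d, e} := (Ideal.Quotient.mkₐ K _).toLinearMap.comp φ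
  have hker : LinearMap.ker f ≤ I := fun w hw => hI w (Ideal.Quotient.eq_zero_iff_mem.mp hw)
  calc (Module.finrank K (W ⧸ I) : ℕ∞) = Module.length K (W ⧸ I) :=
        (Module.length_eq_finrank K (W ⧸ I)).symm
    _ ≤ Module.length K (W ⧸ LinearMap.ker f) :=
        Module.length_le_of_surjective (Submodule.factor hker) (Submodule.factor_surjective hker)
    _ = Module.length K (LinearMap.range f) := f.quotKerEquivRange.length_eq
    _ ≤ Module.length K (A ⧸ Ideal.span {d, e}) :=
        Module.length_le_of_injective _ (Submodule.subtype_injective _)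
    _ ≤ Module.length A (A ⧸ Ideal.span {d, e}) := length_le_length_of_residue hres _
    _ ≤ _ := length_quotient_span_pair_le hde hd he hint

end

end SchemeNormalization

/-! ### Local rings of fractions on the curve `F = D E` -/

namespace PlaneCurve

open MvPolynomial

section LocalModel

variable {K : Type*} [Field K]

/-- The homogeneous polynomials of degree `n` that lie in the ideal `(D, E)` locally at `v`. -/
def localPart (D E : MvPolynomial (Fin 3) K) (v : Fin 3 → K) (n : ℕ) :
    Submodule K (homogeneousSubmodule (Fin 3) K n) where
  carrier := {G | ∃ s m, s.IsHomogeneous m ∧ eval v s ≠ 0 ∧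
    s * (G : MvPolynomial (Fin 3) K) ∈ Ideal.span {D, E}}
  zero_mem' := ⟨1, 0, isHomogeneous_one _ _, by simp, by simp⟩
  add_mem' := by
    rintro G H ⟨s, m, hsm, hs, hG⟩ ⟨t, k, htk, ht, hH⟩
    refine ⟨s * t, m + k, hsm.mul htk, by simpa using ⟨hs, ht⟩, ?_⟩
    rw [Submodule.coe_add, mul_add]
    refine Ideal.add_mem _ ?_ ?_
    · rw [mul_comm s, mul_assoc]
      exact Ideal.mul_mem_left _ _ hG
    · rw [mul_assoc]
      exact Ideal.mul_mem_left _ _ hH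
  smul_mem' := by
    rintro c G ⟨s, m, hsm, hs, hG⟩
    refine ⟨s, m, hsm, hs, ?_⟩
    rw [Submodule.coe_smul, mul_smul_comm, smul_eq_C_mul]
    exact Ideal.mul_mem_left _ _ hG

theorem mem_localPart {D E : MvPolynomial (Fin 3) K} {v : Fin 3 → K} {n : ℕ}
    {G : homogeneousSubmodule (Fin 3) K n} :
    G ∈ localPart D E v n ↔
      ∃ s m, s.IsHomogeneous m ∧ eval v s ≠ 0 ∧
        s * (G : MvPolynomial (Fin 3) K) ∈ Ideal.span {D, E} := Iff.rfl

/-- A description of `A` as the ring of the fractions `G / s`, with `G` and `s` homogeneous of the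
same degree and `s(v) ≠ 0`, on the curve `V(F)`. The numerators and denominators live in `L`. -/
structure FractionModel (F : MvPolynomial (Fin 3) K) (v : Fin 3 → K) (A L : Type*) [CommRing A]
    [CommRing L] where
  num : MvPolynomial (Fin 3) K →+* L
  incl : A →+* L
  incl_injective : Function.Injective incl
  num_self : num F = 0
  isUnit_num : ∀ s n, s.IsHomogeneous n → eval v s ≠ 0 → IsUnit (num s)
  exists_dvd_of_num_eq_zero : ∀ G n, G.IsHomogeneous n → num G = 0 →
    ∃ t m, t.IsHomogeneous m ∧ eval v t ≠ 0 ∧ F ∣ t * G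
  exists_num : ∀ x : A, ∃ G s n, G.IsHomogeneous n ∧ s.IsHomogeneous n ∧ eval v s ≠ 0 ∧
    incl x * num s = num G
  exists_incl : ∀ G s n, G.IsHomogeneous n → s.IsHomogeneous n → eval v s ≠ 0 →
    ∃ x : A, incl x * num s = num G

namespace FractionModel

variable {F D E : MvPolynomial (Fin 3) K} {v : Fin 3 → K} {A L : Type*} [CommRing A] [CommRing L]
  (M : FractionModel F v A L) {a b : ℕ}

include M

theorem eq_zero_of_incl {x : A} (h : M.incl x = 0) : x = 0 :=
  M.incl_injective (by rw [h, map_zero])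

/-- The constants. -/
noncomputable def constHom : K →+* A :=
  (RingEquiv.ofLeftInverse (Function.leftInverse_invFun M.incl_injective)).symm.toRingHom.comp
    ((M.num.comp C).codRestrict M.incl.range fun c => by
      obtain ⟨x, hx⟩ := M.exists_incl (C c) 1 0 (isHomogeneous_C _ _) (isHomogeneous_one _ _)
        (by simp)
      exact ⟨x, by simpa using hx⟩)

theorem incl_constHom (c : K) : M.incl (M.constHom c) = M.num (C c) :=
  congrArg Subtype.val ((RingEquiv.ofLeftInverse
    (Function.leftInverse_invFun M.incl_injective)).apply_symm_apply
      ⟨M.num (C c), _⟩)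

/-- The constant is the value of the fraction at `v`. An inverse of the difference would give a
multiple of `F` with nonzero value at `v`. -/
theorem exists_sub_const_not_isUnit (hFv : eval v F = 0) (x : A) :
    ∃ c : K, ¬ IsUnit (x - M.constHom c) := by
  obtain ⟨G, s, n, hG, hs, hsv, hx⟩ := M.exists_num x
  refine ⟨eval v G / eval v s, fun hu => ?_⟩
  obtain ⟨y, hy⟩ := hu.exists_right_inv
  obtain ⟨H, r, m, hH, hr, hrv, hy'⟩ := M.exists_num y
  have h1 := congrArg M.incl hy
  rw [map_mul, map_sub, incl_constHom, map_one] at h1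
  have h2 : M.num ((G - C (eval v G / eval v s) * s) * H - s * r) = 0 := by
    rw [map_sub, map_mul, map_sub, map_mul, map_mul, ← hx, ← hy']
    linear_combination M.num s * M.num r * h1
  have hhom : ((G - C (eval v G / eval v s) * s) * H - s * r).IsHomogeneous (n + m) :=
    ((hG.sub (hs.C_mul _)).mul hH).sub (hs.mul hr)
  obtain ⟨t, k, -, htv, q, hq⟩ := M.exists_dvd_of_num_eq_zero _ _ hhom h2
  have h3 := congrArg (eval v) hq
  simp only [map_mul, map_sub, eval_C, hFv, zero_mul, div_mul_cancel₀ _ hsv, sub_self,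
    zero_sub] at h3
  simp [htv, hsv, hrv] at h3

/-- Up to a form that is nonzero at `v`, the product of `D` with the numerator of `x` is a multiple
of `F = D E`, and `D` cancels. Here `d` and `e` are `D` and `E` divided by powers of a linear form
not vanishing at `v`. -/
theorem dvd_of_mul_eq_zero (hF : F = D * E) (hF0 : F ≠ 0) (hD : D.IsHomogeneous a)
    (hE : E.IsHomogeneous b) {c : Fin 3 → K} (hc : eval v (linForm c) ≠ 0) {d e : A}
    (hd : M.incl d * M.num (linForm c ^ a) = M.num D)
    (he : M.incl e * M.num (linForm c ^ b) = M.num E) {x : A} (hx : d * x = 0) : e ∣ x := by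
  have hD0 : D ≠ 0 := left_ne_zero_of_mul (hF ▸ hF0)
  obtain ⟨G, s, n, hG, hs, hsv, hx'⟩ := M.exists_num x
  have h1 : M.num (D * G) = 0 := by
    have := congrArg M.incl hx
    rw [map_mul, map_zero] at this
    rw [map_mul, ← hd, ← hx']
    linear_combination M.num (linForm c ^ a) * M.num s * this
  obtain ⟨t, m, ht, htv, q, hq⟩ := M.exists_dvd_of_num_eq_zero _ _ (hD.mul hG) h1
  have hq : t * G = E * q := mul_left_cancel₀ hD0 (by rw [hF] at hq; linear_combination hq)
  have ht0 : t ≠ 0 := fun h => htv (by simp [h])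
  by_cases hG0 : G = 0
  · have hx0 : M.incl x * M.num s = 0 * M.num s := by rw [hx', hG0, map_zero, zero_mul]
    rw [M.eq_zero_of_incl ((M.isUnit_num s n hs hsv).mul_right_cancel hx0)]
    exact dvd_zero e
  have hEq0 : E * q ≠ 0 := hq ▸ mul_ne_zero ht0 hG0
  have hEq : (E * q).IsHomogeneous (m + n) := hq ▸ ht.mul hG
  have hqh := hEq.of_dvd hEq0 (dvd_mul_left q E)
  have hdeg : b + q.totalDegree = m + n := (hE.mul hqh).inj_right hEq hEq0
  have hℓ := (isHomogeneous_linForm c).pow b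
  rw [one_mul] at hℓ
  have hℓv : eval v (linForm c ^ b) ≠ 0 := by rw [map_pow]; exact pow_ne_zero _ hc
  obtain ⟨y, hy⟩ := M.exists_incl (linForm c ^ b * q) (t * s) (m + n) (hdeg ▸ hℓ.mul hqh)
    (ht.mul hs) (by rw [map_mul]; exact mul_ne_zero htv hsv)
  refine ⟨y, M.incl_injective ?_⟩
  apply (M.isUnit_num (t * s) (m + n) (ht.mul hs)
    (by rw [map_mul]; exact mul_ne_zero htv hsv)).mul_right_cancel
  have h2 := congrArg M.num hq
  rw [map_mul, map_mul] at h2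
  rw [map_mul M.incl, mul_assoc, hy, map_mul, map_mul]
  linear_combination M.num t * hx' + h2 - M.num q * he

/-- After clearing denominators, a common multiple is divisible by both `D` and `E`, hence by `D E =
F` since they are coprime. -/
theorem eq_zero_of_dvd_of_dvd (hF : F = D * E) (hD : D.IsHomogeneous a)
    (hE : E.IsHomogeneous b) (hrel : IsRelPrime D E) {c : Fin 3 → K}
    (hc : eval v (linForm c) ≠ 0) {d e : A}
    (hd : M.incl d * M.num (linForm c ^ a) = M.num D)
    (he : M.incl e * M.num (linForm c ^ b) = M.num E) {x : A} (hdx : d ∣ x) (hex : e ∣ x) :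
    x = 0 := by
  obtain ⟨α, rfl⟩ := hdx
  obtain ⟨β, hβ⟩ := hex
  obtain ⟨G, s, n, hG, hs, hsv, hα'⟩ := M.exists_num α
  obtain ⟨H, r, m, hH, hr, hrv, hβ'⟩ := M.exists_num β
  have hβ := congrArg M.incl hβ
  rw [map_mul, map_mul] at hβ
  have hℓ : ∀ k, (linForm c ^ k).IsHomogeneous k := fun k => by
    simpa using (isHomogeneous_linForm c).pow k
  have hu : ∀ k, IsUnit (M.num (linForm c ^ k)) := fun k =>
    M.isUnit_num _ k (hℓ k) (by rw [map_pow]; exact pow_ne_zero _ hc)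
  have h1 : M.num (D * G * (linForm c ^ b * r) - E * H * (linForm c ^ a * s)) = 0 := by
    simp only [map_sub, map_mul]
    rw [← hd, ← he, ← hα', ← hβ']
    linear_combination M.num s * M.num r * M.num (linForm c ^ b) * M.num (linForm c ^ a) * hβ
  have hhom : (D * G * (linForm c ^ b * r) - E * H * (linForm c ^ a * s)).IsHomogeneous
      (a + n + (b + m)) := by
    refine ((hD.mul hG).mul ((hℓ b).mul hr)).sub ?_
    have := (hE.mul hH).mul ((hℓ a).mul hs)
    rwa [show b + m + (a + n) = a + n + (b + m) by ring] at this
  obtain ⟨t, k, ht, htv, q, hq⟩ := M.exists_dvd_of_num_eq_zero _ _ hhom h1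
  have h2 : D ∣ E * (t * H * (linForm c ^ a * s)) :=
    ⟨t * G * (linForm c ^ b * r) - E * q, by rw [hF] at hq; linear_combination -hq⟩
  obtain ⟨y, hy⟩ := hrel.dvd_of_dvd_mul_left h2
  have h3 : M.num E * M.num H * (M.num t * M.num (linForm c ^ a) * M.num s) = 0 := by
    simp only [← map_mul]
    rw [show E * H * (t * linForm c ^ a * s) = F * y by rw [hF]; linear_combination E * hy,
      map_mul, M.num_self, zero_mul]
  have h4 : M.num E * M.num H = 0 :=
    (((M.isUnit_num t k ht htv).mul (hu a)).mul (M.isUnit_num s n hs hsv)).mul_left_eq_zero.mp h3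
  apply M.eq_zero_of_incl
  rw [map_mul, hβ]
  apply ((hu b).mul (M.isUnit_num r m hr hrv)).mul_left_eq_zero.mp
  rw [← h4, ← he, ← hβ']
  ring

/-- Division by the `n`-th power of a linear form not vanishing at `v` maps the forms of degree `n`
to the local ring, and only forms that lie in `(D, E)` locally at `v` can land in `(d, e)`. -/
theorem finrank_quotient_localPart_le [IsLocalRing A] (hF : F = D * E) (hF0 : F ≠ 0)
    (hD : D.IsHomogeneous a) (hE : E.IsHomogeneous b) (hrel : IsRelPrime D E)
    (hv : v ≠ 0) (hFv : eval v F = 0) (n : ℕ) :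
    (Module.finrank K (homogeneousSubmodule (Fin 3) K n ⧸ localPart D E v n) : ℕ∞) ≤
      Module.length A (integralClosure A (FractionRing A) ⧸
        LinearMap.range (Algebra.linearMap A (integralClosure A (FractionRing A)))) := by
  obtain ⟨c, hc⟩ := exists_linForm_ne_zero hv
  have hℓ : ∀ k, (linForm c ^ k).IsHomogeneous k := fun k => by
    simpa using (isHomogeneous_linForm c).pow k
  have hℓv : ∀ k, eval v (linForm c ^ k) ≠ 0 := fun k => by
    rw [map_pow]; exact pow_ne_zero _ hc
  have hu : ∀ k, IsUnit (M.num (linForm c ^ k)) := fun k => M.isUnit_num _ k (hℓ k) (hℓv k)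
  obtain ⟨d, hd⟩ := M.exists_incl D (linForm c ^ a) a hD (hℓ a) (hℓv a)
  obtain ⟨e, he⟩ := M.exists_incl E (linForm c ^ b) b hE (hℓ b) (hℓv b)
  let : Algebra K A := M.constHom.toAlgebra
  have hφ : ∀ G : homogeneousSubmodule (Fin 3) K n, ∃ x : A,
      M.incl x * M.num (linForm c ^ n) = M.num G :=
    fun G => M.exists_incl G _ n G.2 (hℓ n) (hℓv n)
  choose φ hφ using hφ
  let f : homogeneousSubmodule (Fin 3) K n →ₗ[K] A :=
    { toFun := φ
      map_add' := fun G H => M.incl_injective ((hu n).mul_right_cancel (by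
        rw [map_add, add_mul, hφ, hφ, hφ, Submodule.coe_add, map_add]))
      map_smul' := fun x G => M.incl_injective ((hu n).mul_right_cancel (by
        rw [hφ, RingHom.id_apply, Algebra.smul_def, map_mul, mul_assoc, hφ, Submodule.coe_smul,
          smul_eq_C_mul, map_mul, ← incl_constHom]
        rfl)) }
  refine SchemeNormalization.finrank_quotient_le_length (K := K) (d := d) (e := e)
    (fun x => ?_) ?_ ?_ ?_ ?_ f _ ?_
  · obtain ⟨y, hy⟩ := M.exists_sub_const_not_isUnit hFv x
    exact ⟨y, (IsLocalRing.mem_maximalIdeal _).mpr hy⟩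
  · apply M.eq_zero_of_incl
    apply ((hu a).mul (hu b)).mul_left_eq_zero.mp
    have := (congrArg M.num hF).symm.trans M.num_self
    rw [map_mul, ← hd, ← he] at this
    rw [map_mul, ← this]
    ring
  · exact fun x hx => M.dvd_of_mul_eq_zero hF hF0 hD hE hc hd he hx
  · exact fun x hx => M.dvd_of_mul_eq_zero (hF.trans (mul_comm D E)) hF0 hE hD hc he hd hx
  · exact fun x h1 h2 => M.eq_zero_of_dvd_of_dvd hF hD hE hrel hc hd he h1 h2
  · intro G hG
    obtain ⟨α, β, hαβ⟩ := Ideal.mem_span_pair.mp hG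
    obtain ⟨A₁, s, m, hA, hs, hsv, hα⟩ := M.exists_num α
    obtain ⟨B₁, r, k, hB, hr, hrv, hβ⟩ := M.exists_num β
    have h1 := congrArg M.incl hαβ
    rw [map_add, map_mul, map_mul] at h1
    have h2 : M.num ((G : MvPolynomial (Fin 3) K) * (linForm c ^ a * s * (linForm c ^ b * r)) -
        linForm c ^ n * (D * A₁ * (linForm c ^ b * r) + E * B₁ * (linForm c ^ a * s))) = 0 := by
      have h3 : M.incl (f G) * M.num (linForm c ^ n) = M.num G := hφ G
      simp only [map_sub, map_add, map_mul]
      rw [← h3, ← hd, ← he, ← hα, ← hβ]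
      linear_combination -M.num s * M.num r * M.num (linForm c ^ b) * M.num (linForm c ^ a) *
        M.num (linForm c ^ n) * h1
    have hhom : ((G : MvPolynomial (Fin 3) K) * (linForm c ^ a * s * (linForm c ^ b * r)) -
        linForm c ^ n * (D * A₁ * (linForm c ^ b * r) +
          E * B₁ * (linForm c ^ a * s))).IsHomogeneous (n + (a + m + (b + k))) := by
      refine (IsHomogeneous.mul G.2 (((hℓ a).mul hs).mul ((hℓ b).mul hr))).sub
        ((hℓ n).mul (((hD.mul hA).mul ((hℓ b).mul hr)).add ?_))
      have := (hE.mul hB).mul ((hℓ a).mul hs)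
      rwa [show b + k + (a + m) = a + m + (b + k) by ring] at this
    obtain ⟨t, j, ht, htv, q, hq⟩ := M.exists_dvd_of_num_eq_zero _ _ hhom h2
    refine ⟨t * (linForm c ^ a * s * (linForm c ^ b * r)), _,
      ht.mul (((hℓ a).mul hs).mul ((hℓ b).mul hr)), ?_, ?_⟩
    · simp only [map_mul]
      exact mul_ne_zero htv (mul_ne_zero (mul_ne_zero (hℓv a) hsv) (mul_ne_zero (hℓv b) hrv))
    · refine Ideal.mem_span_pair.mpr ⟨E * q + t * linForm c ^ n * (A₁ * (linForm c ^ b * r)),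
        t * linForm c ^ n * (B₁ * (linForm c ^ a * s)), ?_⟩
      rw [hF] at hq
      linear_combination -hq

end FractionModel

end LocalModel

end PlaneCurve

/-! ### Points of `V(F)` as homogeneous primes -/

namespace PlaneCurve

open MvPolynomial

attribute [local instance] MvPolynomial.gradedAlgebra

theorem decompose_homogeneousSubmodule {K : Type*} [Field K] (p : MvPolynomial (Fin 3) K) (n : ℕ) :
    (DirectSum.decompose (homogeneousSubmodule (Fin 3) K) p n : MvPolynomial (Fin 3) K) =
      homogeneousComponent n p :=
  decomposition.decompose'_apply p n

section Points

variable {K : Type u} [Field K] {F : MvPolynomial (Fin 3) K} {f : ℕ} (hF : F.IsHomogeneous f)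

/-- The homogeneous prime ideal of a point of `V(F)`. -/
noncomputable def idealOf (x : curve hF) : Ideal (CoordRing F) :=
  letI := gradedAlgebra hF
  letI y : ProjectiveSpectrum (grading F) := x
  y.asHomogeneousIdeal.toIdeal

instance (x : curve hF) : (idealOf hF x).IsPrime :=
  letI := gradedAlgebra hF
  letI y : ProjectiveSpectrum (grading F) := x
  y.isPrime

theorem mk_homogeneousComponent_mem_idealOf {x : curve hF} {G : MvPolynomial (Fin 3) K}
    (hG : Ideal.Quotient.mk (Ideal.span {F}) G ∈ idealOf hF x) (n : ℕ) :
    Ideal.Quotient.mk (Ideal.span {F}) (homogeneousComponent n G) ∈ idealOf hF x := by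
  let := gradedAlgebra hF
  let y : ProjectiveSpectrum (grading F) := x
  have h := y.asHomogeneousIdeal.isHomogeneous n hG
  have h2 : DirectSum.decompose (grading F) (Ideal.Quotient.mk (Ideal.span {F}) G) =
      decomposePoly F G :=
    decomposePoly_eq_of_mk_eq hF (Function.surjInv_eq _ _)
  rwa [h2, decomposePoly_apply, decompose_homogeneousSubmodule] at h

theorem mk_mem_idealOf_iff {x : curve hF} {G : MvPolynomial (Fin 3) K} :
    Ideal.Quotient.mk (Ideal.span {F}) G ∈ idealOf hF x ↔
      ∀ n, Ideal.Quotient.mk (Ideal.span {F}) (homogeneousComponent n G) ∈ idealOf hF x := by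
  refine ⟨fun h n => mk_homogeneousComponent_mem_idealOf hF h n, fun h => ?_⟩
  rw [← sum_homogeneousComponent G, map_sum]
  exact Ideal.sum_mem _ fun i _ => h i

theorem isPointAt_iff {x : curve hF} {v : Fin 3 → K} :
    IsPointAt hF x v ↔ ∀ (n : ℕ) (G : MvPolynomial (Fin 3) K), G.IsHomogeneous n →
      (Ideal.Quotient.mk (Ideal.span {F}) G ∈ idealOf hF x ↔ eval v G = 0) := Iff.rfl

/-- A point of `V(F)` is determined by the homogeneous polynomials that vanish there. -/
theorem curve_ext {x y : curve hF} (h : ∀ (n : ℕ) (G : MvPolynomial (Fin 3) K), G.IsHomogeneous n →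
    (Ideal.Quotient.mk (Ideal.span {F}) G ∈ idealOf hF x ↔
      Ideal.Quotient.mk (Ideal.span {F}) G ∈ idealOf hF y)) : x = y := by
  let := gradedAlgebra hF
  have h1 : idealOf hF x = idealOf hF y := by
    ext z
    obtain ⟨G, rfl⟩ := Ideal.Quotient.mk_surjective z
    rw [mk_mem_idealOf_iff, mk_mem_idealOf_iff]
    exact forall_congr' fun n => h n _ (homogeneousComponent_isHomogeneous _ _)
  exact ProjectiveSpectrum.ext (HomogeneousIdeal.ext h1)

theorem IsPointAt.eq_of_smul {x y : curve hF} {v : Fin 3 → K} {c : K} (hc : c ≠ 0)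
    (hx : IsPointAt hF x v) (hy : IsPointAt hF y (c • v)) : x = y := by
  refine curve_ext hF fun n G hG => ?_
  rw [(isPointAt_iff hF).mp hx n G hG, (isPointAt_iff hF).mp hy n G hG, hG.eval_smul]
  simp [hc]

theorem specializes_iff {x y : curve hF} :
    x ⤳ y ↔ ∀ (n : ℕ) (G : MvPolynomial (Fin 3) K), G.IsHomogeneous n →
      Ideal.Quotient.mk (Ideal.span {F}) G ∈ idealOf hF x →
      Ideal.Quotient.mk (Ideal.span {F}) G ∈ idealOf hF y := by
  let := gradedAlgebra hF
  let x' : ProjectiveSpectrum (grading F) := x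
  let y' : ProjectiveSpectrum (grading F) := y
  have : x ⤳ y ↔ x' ≤ y' := by
    rw [specializes_iff_mem_closure]
    exact (ProjectiveSpectrum.le_iff_mem_closure (grading F) x' y').symm
  rw [this]
  constructor
  · exact fun h n G _ hG => h hG
  · intro h z hz
    obtain ⟨G, rfl⟩ := Ideal.Quotient.mk_surjective z
    exact (mk_mem_idealOf_iff hF).mpr fun n =>
      h n _ (homogeneousComponent_isHomogeneous _ _) ((mk_mem_idealOf_iff hF).mp hz n)

theorem exists_point_of_prime (P : Ideal (MvPolynomial (Fin 3) K)) [P.IsPrime]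
    (hP : ∀ p ∈ P, ∀ n, homogeneousComponent n p ∈ P) (hFP : F ∈ P) (hX : ∃ i, X i ∉ P) :
    ∃ x : curve hF, ∀ G, Ideal.Quotient.mk (Ideal.span {F}) G ∈ idealOf hF x ↔ G ∈ P := by
  let := gradedAlgebra hF
  have hker : RingHom.ker (Ideal.Quotient.mk (Ideal.span {F})) ≤ P := by
    rw [Ideal.mk_ker, Ideal.span_singleton_le_iff_mem]; exact hFP
  let Q : Ideal (CoordRing F) := P.map (Ideal.Quotient.mk (Ideal.span {F}))
  have hQ : ∀ G, Ideal.Quotient.mk (Ideal.span {F}) G ∈ Q ↔ G ∈ P := by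
    intro G
    rw [← Ideal.mem_comap, Ideal.comap_map_of_surjective' _ Ideal.Quotient.mk_surjective,
      sup_eq_left.mpr hker]
  have hprime : Q.IsPrime := Ideal.map_isPrime_of_surjective Ideal.Quotient.mk_surjective hker
  have hhom : Q.IsHomogeneous (grading F) := by
    intro n z hz
    obtain ⟨G, rfl⟩ := Ideal.Quotient.mk_surjective z
    have h2 : DirectSum.decompose (grading F) (Ideal.Quotient.mk (Ideal.span {F}) G) =
        decomposePoly F G :=
      decomposePoly_eq_of_mk_eq hF (Function.surjInv_eq _ _)
    rw [h2, decomposePoly_apply, decompose_homogeneousSubmodule]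
    exact (hQ _).mpr (hP G ((hQ G).mp hz) n)
  let y : ProjectiveSpectrum (grading F) := ⟨⟨Q, hhom⟩, hprime, by
    obtain ⟨i, hi⟩ := hX
    intro hle
    apply hi
    rw [← hQ]
    apply hle
    refine HomogeneousIdeal.mem_irrelevant_of_mem _ (i := 1) one_pos ?_
    exact ⟨X i, isHomogeneous_X _ _, rfl⟩⟩
  exact ⟨y, hQ⟩

theorem exists_X_notMem_idealOf (x : curve hF) :
    ∃ i, Ideal.Quotient.mk (Ideal.span {F}) (X i) ∉ idealOf hF x := by
  let := gradedAlgebra hF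
  let y : ProjectiveSpectrum (grading F) := x
  by_contra! h
  apply y.not_irrelevant_le
  refine (HomogeneousIdeal.toIdeal_irrelevant_le (grading F)).mpr ?_
  rintro n hn _ ⟨G, hG, rfl⟩
  change Ideal.Quotient.mk (Ideal.span {F}) G ∈ idealOf hF x
  rw [← support_sum_monomial_coeff G, map_sum]
  refine Ideal.sum_mem _ fun d hd => ?_
  obtain ⟨i, hi⟩ : ∃ i, d i ≠ 0 := by
    by_contra! h0
    have hd0 : d.degree = 0 := by simp [show d = 0 from Finsupp.ext h0]
    by_cases hdn : d.degree = n
    · omega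
    · exact (mem_support_iff.mp hd) (IsHomogeneous.coeff_eq_zero hG hdn)
  obtain ⟨q, hq⟩ : X i ∣ monomial d (coeff d G) := X_dvd_monomial.mpr (Or.inr hi)
  rw [hq, map_mul]
  exact Ideal.mul_mem_right _ _ (h i)

theorem exists_isPointAt {v : Fin 3 → K} (hv : v ≠ 0) (hFv : eval v F = 0) :
    ∃ x : curve hF, IsPointAt hF x v := by
  -- This sends `p` to `∑ pₙ(v) Tⁿ`. Its kernel is prime because the target is a domain, and
  -- homogeneous because it is tested on each `pₙ`.
  let φ : MvPolynomial (Fin 3) K →+* Polynomial K :=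
    (Polynomial.mapRingHom (eval v)).comp (homogenization : _ →ₐ[K] _).toRingHom
  have hφ : ∀ p n, (φ p).coeff n = eval v (homogeneousComponent n p) := fun p n => by
    change (Polynomial.map (eval v) (homogenization p)).coeff n = _
    rw [Polynomial.coeff_map, coeff_homogenization]
  have hmem : ∀ p, p ∈ RingHom.ker φ ↔ ∀ n, eval v (homogeneousComponent n p) = 0 := fun p => by
    rw [RingHom.mem_ker, Polynomial.ext_iff]
    simp [hφ]
  have hmemh : ∀ p n, p.IsHomogeneous n → (p ∈ RingHom.ker φ ↔ eval v p = 0) := by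
    intro p n hp
    rw [hmem]
    refine ⟨fun h => by simpa [homogeneousComponent_eq_self hp] using h n, fun h m => ?_⟩
    rw [homogeneousComponent_of_mem hp]
    split_ifs <;> simp [h]
  have : (RingHom.ker φ).IsPrime := RingHom.ker_isPrime φ
  obtain ⟨i, hi⟩ := Function.ne_iff.mp hv
  obtain ⟨x, hx⟩ := exists_point_of_prime hF (RingHom.ker φ) (fun p hp n => by
    rw [hmemh _ _ (homogeneousComponent_isHomogeneous _ _)]
    exact (hmem p).mp hp n) ((hmemh F f hF).mpr hFv)
    ⟨i, by rw [hmemh _ _ (isHomogeneous_X _ _), eval_X]; exact hi⟩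
  exact ⟨x, fun n G hG => (hx G).trans (hmemh G n hG)⟩

/-- The points of `V(F)` with homogeneous coordinates are closed. -/
theorem IsPointAt.eq_of_specializes {x y : curve hF} {v : Fin 3 → K}
    (hx : IsPointAt hF x v) (h : x ⤳ y) : x = y := by
  rw [specializes_iff] at h
  refine curve_ext hF fun n G hG => ⟨h n G hG, fun hy => ?_⟩
  rw [(isPointAt_iff hF).mp hx n G hG]
  by_contra hGv
  obtain ⟨i, hi⟩ := exists_X_notMem_idealOf hF y
  -- This form vanishes at `v`, so it lies in the ideal of `y`. As `G` lies there too and `G(v) ≠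
  -- 0`, so does `X i ^ n`.
  have h1 : (C (eval v G) * X i ^ n - C (v i ^ n) * G).IsHomogeneous n :=
    (((isHomogeneous_X_pow i n)).C_mul _).sub (hG.C_mul _)
  have h2 := h n _ h1 (((isPointAt_iff hF).mp hx n _ h1).mpr (by simp [mul_comm]))
  rw [map_sub, map_mul, map_mul] at h2
  have h3 := Ideal.add_mem _ h2 (Ideal.mul_mem_left _ (Ideal.Quotient.mk _ (C (v i ^ n))) hy)
  rw [sub_add_cancel] at h3
  have hu : IsUnit (Ideal.Quotient.mk (Ideal.span {F}) (C (eval v G))) :=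
    ((isUnit_iff_ne_zero.mpr hGv).map C).map _
  rw [Ideal.unit_mul_mem_iff_mem _ hu, map_pow] at h3
  exact hi (Ideal.IsPrime.mem_of_pow_mem inferInstance n h3)

theorem exists_genericPoint {p : MvPolynomial (Fin 3) K} (hp : Irreducible p) (hpF : p ∣ F)
    (hF0 : F ≠ 0) :
    ∃ x : curve hF, ∀ G, Ideal.Quotient.mk (Ideal.span {F}) G ∈ idealOf hF x ↔ p ∣ G := by
  have hph := hF.of_dvd hF0 hpF
  have : (Ideal.span {p}).IsPrime :=
    (Ideal.span_singleton_prime hp.ne_zero).mpr hp.prime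
  have hX : ∃ i : Fin 3, X i ∉ Ideal.span {p} := by
    by_contra! h
    simp only [Ideal.mem_span_singleton] at h
    have h1 := (hp.dvd_irreducible_iff_associated (X_prime (R := K)).irreducible).mp (h 0)
    have h2 := h1.symm.dvd.trans (h 1)
    exact absurd (X_dvd_X.mp h2) (by decide)
  obtain ⟨x, hx⟩ := exists_point_of_prime hF (Ideal.span {p}) (fun q hq n => by
    rw [Ideal.mem_span_singleton] at hq ⊢
    obtain ⟨r, rfl⟩ := hq
    exact dvd_homogeneousComponent_mul hph r n)
    (Ideal.mem_span_singleton.mpr hpF) hX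
  exact ⟨x, fun G => (hx G).trans Ideal.mem_span_singleton⟩

end Points

end PlaneCurve

/-! ### Bézout's inequality for the delta invariants -/

namespace PlaneCurve

open MvPolynomial

attribute [local instance] MvPolynomial.gradedAlgebra

section Stalk

variable {K : Type u} [Field K] {F : MvPolynomial (Fin 3) K} {f : ℕ} (hF : F.IsHomogeneous f)

/-- The stalk of `V(F)` at a point with homogeneous coordinates consists of fractions. -/
theorem nonempty_fractionModel {x : curve hF} {v : Fin 3 → K} (hx : IsPointAt hF x v) :
    Nonempty (FractionModel F v ((curve hF).presheaf.stalk x)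
      (Localization.AtPrime (idealOf hF x))) := by
  let := gradedAlgebra hF
  let y : ProjectiveSpectrum (grading F) := x
  let L := Localization.AtPrime (idealOf hF x)
  let σ : (curve hF).presheaf.stalk x ≃+*
      HomogeneousLocalization.AtPrime (grading F) y.asHomogeneousIdeal.toIdeal :=
    (Proj.stalkIso (grading F) y).commRingCatIsoToRingEquiv
  let val : HomogeneousLocalization.AtPrime (grading F) y.asHomogeneousIdeal.toIdeal →+* L :=
    algebraMap _ (Localization.AtPrime y.asHomogeneousIdeal.toIdeal)
  let num : MvPolynomial (Fin 3) K →+* L :=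
    (algebraMap (CoordRing F) L).comp (Ideal.Quotient.mk (Ideal.span {F}))
  have hnum : ∀ G, num G = algebraMap (CoordRing F) L (Ideal.Quotient.mk _ G) := fun G => rfl
  have hx' := (isPointAt_iff hF).mp hx
  have hfrac : ∀ G s n (hG : G.IsHomogeneous n) (hs : s.IsHomogeneous n) (hsv : eval v s ≠ 0),
      val (HomogeneousLocalization.mk ⟨n, ⟨Ideal.Quotient.mk _ G, G, hG, rfl⟩,
        ⟨Ideal.Quotient.mk _ s, s, hs, rfl⟩, fun h => hsv ((hx' n s hs).mp h)⟩) * num s =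
          num G := by
    intro G s n hG hs hsv
    change Localization.mk _ _ * algebraMap (CoordRing F) L _ = _
    rw [Localization.mk_eq_mk']
    exact IsLocalization.mk'_spec L _ (⟨_, _⟩ : (idealOf hF x).primeCompl)
  exact ⟨{
    num := num
    incl := val.comp σ.toRingHom
    incl_injective := (HomogeneousLocalization.val_injective _).comp σ.injective
    num_self := by rw [hnum, Ideal.Quotient.mk_singleton_self, map_zero]
    isUnit_num := fun s n hs hsv => IsLocalization.map_units L
      (⟨Ideal.Quotient.mk _ s, fun h => hsv ((hx' n s hs).mp h)⟩ : (idealOf hF x).primeCompl)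
    exists_dvd_of_num_eq_zero := by
      intro G n hG h
      rw [hnum, IsLocalization.map_eq_zero_iff (idealOf hF x).primeCompl] at h
      obtain ⟨⟨t, ht⟩, h⟩ := h
      obtain ⟨t, rfl⟩ := Ideal.Quotient.mk_surjective t
      have ht : Ideal.Quotient.mk _ t ∉ idealOf hF x := ht
      rw [mk_mem_idealOf_iff] at ht
      push Not at ht
      obtain ⟨m, hm⟩ := ht
      -- The annihilating element need not be homogeneous, but some homogeneous part of it is
      -- nonzero at `v`, and divisibility by the form `F` passes to homogeneous parts.
      refine ⟨homogeneousComponent m t, m, homogeneousComponent_isHomogeneous _ _,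
        fun h0 => hm ((hx' m _ (homogeneousComponent_isHomogeneous _ _)).mpr h0), ?_⟩
      have h : F ∣ t * G := by
        rw [← Ideal.mem_span_singleton, ← Ideal.Quotient.eq_zero_iff_mem, map_mul]
        exact h
      obtain ⟨q, hq⟩ := h
      rw [mul_comm, ← homogeneousComponent_mul_of_isHomogeneous hG, mul_comm G, hq]
      exact dvd_homogeneousComponent_mul hF q _
    exists_num := by
      intro z
      obtain ⟨⟨n, ⟨_, G, hG, rfl⟩, ⟨_, s, hs, rfl⟩, hsx⟩, hw⟩ :=
        HomogeneousLocalization.mk_surjective (σ z)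
      have hsv : eval v s ≠ 0 := fun h => hsx ((hx' n s hs).mpr h)
      refine ⟨G, s, n, hG, hs, hsv, ?_⟩
      change val (σ z) * num s = num G
      rw [← hw]
      exact hfrac G s n hG hs hsv
    exists_incl := by
      intro G s n hG hs hsv
      refine ⟨σ.symm (HomogeneousLocalization.mk ⟨n, ⟨Ideal.Quotient.mk _ G, G, hG, rfl⟩,
        ⟨Ideal.Quotient.mk _ s, s, hs, rfl⟩, fun h => hsv ((hx' n s hs).mp h)⟩), ?_⟩
      change val (σ (σ.symm _)) * num s = num G
      rw [σ.apply_symm_apply]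
      exact hfrac G s n hG hs hsv }⟩

variable {D E : MvPolynomial (Fin 3) K} {a b : ℕ}

theorem finrank_quotient_localPart_le_delta (hDE : F = D * E) (hF0 : F ≠ 0)
    (hD : D.IsHomogeneous a) (hE : E.IsHomogeneous b) (hrel : IsRelPrime D E)
    {x : curve hF} {v : Fin 3 → K} (hx : IsPointAt hF x v) (hv : v ≠ 0) (hFv : eval v F = 0)
    (n : ℕ) :
    (Module.finrank K (homogeneousSubmodule (Fin 3) K n ⧸ localPart D E v n) : ℕ∞) ≤
      SchemeNormalization.delta (curve hF) x :=
  (nonempty_fractionModel hF hx).some.finrank_quotient_localPart_le hDE hF0 hD hE hrel hv hFv n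

theorem sum_delta_le_totalDelta {X : Scheme.{u}} {S : Set X} {T : Finset X}
    (hT : (T : Set X) ⊆ S) :
    ∑ x ∈ T, SchemeNormalization.delta X x ≤ SchemeNormalization.totalDelta X S :=
  le_iSup₂_of_le T hT le_rfl

theorem finrank_le_finrank_iInf_add_sum {k W ι : Type*} [Field k] [AddCommGroup W] [Module k W]
    [Module.Finite k W] [Fintype ι] (I : ι → Submodule k W) :
    Module.finrank k W ≤ Module.finrank k (⨅ i, I i : Submodule k W) +
      ∑ i, Module.finrank k (W ⧸ I i) := by
  let φ : W →ₗ[k] ((i : ι) → W ⧸ I i) := LinearMap.pi fun i => (I i).mkQ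
  have hker : LinearMap.ker φ = ⨅ i, I i := by
    rw [LinearMap.ker_pi]
    simp
  have h1 := φ.finrank_range_add_finrank_ker
  have h2 := Submodule.finrank_le (LinearMap.range φ)
  rw [Module.finrank_pi_fintype] at h2
  rw [← hker]
  omega

variable [IsAlgClosed K]

/-- The forms of degree `a + b` have a quotient of dimension `a b` modulo `(D, E)`. By Noether's
theorem this quotient embeds into the sum of the local quotients at the common points, each of
dimension at most delta. -/
theorem mul_le_totalDelta (hDE : F = D * E) (hF0 : F ≠ 0)
    (hD : D.IsHomogeneous a) (hE : E.IsHomogeneous b) (ha : a ≠ 0) (hrel : IsRelPrime D E)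
    (S : Set (curve hF))
    (hS : ∀ v ≠ 0, eval v D = 0 → eval v E = 0 → ∃ x ∈ S, IsPointAt hF x v) :
    ((a * b : ℕ) : ℕ∞) ≤ SchemeNormalization.totalDelta (curve hF) S := by
  have hFv : ∀ v, eval v D = 0 → eval v F = 0 := fun v h => by rw [hDE, map_mul, h, zero_mul]
  by_cases htop : SchemeNormalization.totalDelta (curve hF) S = ⊤
  · rw [htop]; exact le_top
  -- The common points of `D` and `E` in `S`. Each has delta at least one, so a finite total leaves
  -- only finitely many.
  let S' : Set (curve hF) :=
    {x | x ∈ S ∧ ∃ v, v ≠ 0 ∧ eval v D = 0 ∧ eval v E = 0 ∧ IsPointAt hF x v}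
  have hone : ∀ x ∈ S', 1 ≤ SchemeNormalization.delta (curve hF) x := by
    rintro x ⟨-, v, hv, hDv, hEv, hx⟩
    refine le_trans ?_ (finrank_quotient_localPart_le_delta hF hDE hF0 hD hE hrel hx hv
      (hFv v hDv) 0)
    have hne : localPart D E v 0 ≠ ⊤ := by
      intro h
      have h1 : (⟨1, isHomogeneous_one _ _⟩ : homogeneousSubmodule (Fin 3) K 0) ∈
          localPart D E v 0 := h ▸ Submodule.mem_top
      obtain ⟨s, -, -, hs, hmem⟩ := mem_localPart.mp h1
      obtain ⟨α, β, hαβ⟩ := Ideal.mem_span_pair.mp hmem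
      apply hs
      have := congrArg (eval v) hαβ
      simpa [hDv, hEv, eq_comm] using this
    have : Nontrivial (homogeneousSubmodule (Fin 3) K 0 ⧸ localPart D E v 0) :=
      Submodule.Quotient.nontrivial_iff.mpr hne
    exact_mod_cast Nat.one_le_iff_ne_zero.mpr (Module.finrank_pos (R := K)
      (M := homogeneousSubmodule (Fin 3) K 0 ⧸ localPart D E v 0)).ne'
  have hfin : S'.Finite := by
    by_contra hinf
    obtain ⟨N, hN⟩ := ENat.ne_top_iff_exists.mp htop
    obtain ⟨T, hTS, hT⟩ := Set.Infinite.exists_subset_card_eq hinf (N + 1)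
    have h1 := sum_delta_le_totalDelta (S := S) (T := T) fun x hx => (hTS hx).1
    have h2 : ((N + 1 : ℕ) : ℕ∞) ≤ ∑ x ∈ T, SchemeNormalization.delta (curve hF) x := by
      rw [← hT, Finset.card_eq_sum_ones, Nat.cast_sum]
      exact Finset.sum_le_sum fun x hx => by simpa using hone x (hTS hx)
    have h3 := h2.trans h1
    rw [← hN] at h3
    have : N + 1 ≤ N := by exact_mod_cast h3
    omega
  have : Finite S' := hfin
  choose! V hV using fun (x : curve hF) (hx : x ∈ S') => hx.2
  -- A line that avoids the finitely many common points; it exists because `K` is infinite.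
  obtain ⟨g, hg⟩ := Module.exists_dual_forall_apply_ne_zero (K := K) (fun x : S' => V x)
    fun x => (hV x x.2).1
  let c : Fin 3 → K := fun i => g (Pi.single i 1)
  have hc : ∀ v, eval v (linForm c) = g v := fun v => by
    rw [eval_linForm]
    conv_rhs => rw [← (Pi.basisFun K (Fin 3)).sum_repr v, map_sum]
    simp [c, mul_comm]
  have hex : ∀ v ≠ 0, eval v D = 0 → eval v E = 0 → ∃ x ∈ S', IsPointAt hF x v := by
    intro v hv hDv hEv
    obtain ⟨x, hxS, hx⟩ := hS v hv hDv hEv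
    exact ⟨x, ⟨hxS, v, hv, hDv, hEv, hx⟩, hx⟩
  have hzero : ∀ v, eval v D = 0 → eval v E = 0 → eval v (linForm c) = 0 → v = 0 := by
    intro v hDv hEv hℓ
    by_contra hv
    obtain ⟨x, hxS, hx⟩ := hex v hv hDv hEv
    have h1 := ((isPointAt_iff hF).mp hx 1 _ (isHomogeneous_linForm c)).mpr hℓ
    have h2 := ((isPointAt_iff hF).mp (hV x hxS).2.2.2 1 _ (isHomogeneous_linForm c)).mp h1
    rw [hc] at h2
    exact hg ⟨x, hxS⟩ h2
  obtain ⟨c', hc0, hzero'⟩ : ∃ c' : Fin 3 → K, c' ≠ 0 ∧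
      ∀ v, eval v D = 0 → eval v E = 0 → eval v (linForm c') = 0 → v = 0 := by
    -- The functional can be zero only if there are no common points, and then any nonzero linear
    -- form serves.
    by_cases h0 : c = 0
    · refine ⟨Pi.single 0 1, by simp, fun v hDv hEv _ => hzero v hDv hEv (by simp [h0, linForm])⟩
    · exact ⟨c, h0, hzero⟩
  let := hfin.fintype
  let I := fun x : S' => localPart D E (V x) (a + b + 0)
  have hker : (⨅ x, I x).map (Submodule.subtype _) ≤
      LinearMap.range (combination D E (b + 0) (a + 0)) := by
    rintro _ ⟨G, hG, rfl⟩
    have hGI : ∀ x, G ∈ I x := (Submodule.mem_iInf _).mp hG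
    have hmem : (G : MvPolynomial (Fin 3) K) ∈ Ideal.span {D, E} := by
      refine mem_span_pair_of_forall_zero hD ha hc0 hzero' fun v hv hDv hEv => ?_
      obtain ⟨x, hxS, hx⟩ := hex v hv hDv hEv
      obtain ⟨s, m, hs, hsv, hsG⟩ := mem_localPart.mp (hGI ⟨x, hxS⟩)
      refine ⟨s, fun h0 => hsv ?_, hsG⟩
      have h1 := ((isPointAt_iff hF).mp hx m s hs).mpr h0
      exact ((isPointAt_iff hF).mp (hV x hxS).2.2.2 m s hs).mp h1
    obtain ⟨α, β, hαβ⟩ := Ideal.mem_span_pair.mp hmem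
    -- The coefficients `α` and `β` may be inhomogeneous; only their parts of degrees `b` and `a`
    -- contribute in degree `a + b`.
    refine ⟨⟨⟨homogeneousComponent b α, homogeneousComponent_isHomogeneous _ _⟩,
      ⟨homogeneousComponent a β, homogeneousComponent_isHomogeneous _ _⟩⟩, ?_⟩
    rw [combination_apply]
    change homogeneousComponent b α * D + homogeneousComponent a β * E = G
    rw [mul_comm _ D, mul_comm _ E, ← homogeneousComponent_mul_of_isHomogeneous hD,
      ← homogeneousComponent_mul_of_isHomogeneous hE, add_comm b a, ← map_add, mul_comm D,
      mul_comm E, hαβ]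
    exact homogeneousComponent_eq_self G.2
  have hE0 : E ≠ 0 := right_ne_zero_of_mul (hDE ▸ hF0)
  have h1 := finrank_le_finrank_iInf_add_sum I
  have h2 := finrank_range_combination hD hE hE0 hrel 0
  have : Module.Finite K (LinearMap.range (combination D E (b + 0) (a + 0))) :=
    Module.Finite.range _
  have h3 := Submodule.finrank_mono hker
  rw [Submodule.finrank_map_subtype_eq] at h3
  rw [finrank_homogeneousSubmodule_fin_three] at h1
  have h5 : a * b ≤ ∑ x : S', Module.finrank K
      (homogeneousSubmodule (Fin 3) K (a + b + 0) ⧸ I x) := by omega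
  calc ((a * b : ℕ) : ℕ∞) ≤ ((∑ x : S', Module.finrank K
        (homogeneousSubmodule (Fin 3) K (a + b + 0) ⧸ I x) : ℕ) : ℕ∞) := by exact_mod_cast h5
    _ ≤ ∑ x : S', SchemeNormalization.delta (curve hF) x := by
        rw [Nat.cast_sum]
        refine Finset.sum_le_sum fun x _ => ?_
        obtain ⟨hv, hDv, -, hx⟩ := hV x x.2
        exact finrank_quotient_localPart_le_delta hF hDE hF0 hD hE hrel hx hv (hFv _ hDv) _
    _ = ∑ x ∈ S'.toFinset, SchemeNormalization.delta (curve hF) x := by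
        rw [Finset.sum_set_coe]
    _ ≤ _ := sum_delta_le_totalDelta fun x hx => (Set.mem_toFinset.mp hx).1

end Stalk

end PlaneCurve

/-! ### Factors of a polynomial over an extension of the base field -/

namespace MvPolynomial

section CoeffMap

variable {σ k K : Type*} [Field k] [Field K] [Algebra k K]

/-- Apply a linear functional to the coefficients of a polynomial. -/
noncomputable def coeffMap (μ : K →ₗ[k] k) (p : MvPolynomial σ K) : MvPolynomial σ k :=
  ∑ d ∈ p.support, monomial d (μ (coeff d p))

theorem coeff_coeffMap (μ : K →ₗ[k] k) (p : MvPolynomial σ K) (d : σ →₀ ℕ) :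
    coeff d (coeffMap μ p) = μ (coeff d p) := by
  classical
  rw [coeffMap, coeff_sum]
  simp only [coeff_monomial, Finset.sum_ite_eq', mem_support_iff]
  split_ifs with h
  · rfl
  · rw [not_not.mp h, map_zero]

theorem coeffMap_map_mul (μ : K →ₗ[k] k) (y : MvPolynomial σ k) (p : MvPolynomial σ K) :
    coeffMap μ (map (algebraMap k K) y * p) = y * coeffMap μ p := by
  classical
  ext d
  rw [coeff_coeffMap, coeff_mul, coeff_mul, map_sum]
  refine Finset.sum_congr rfl fun x _ => ?_
  rw [coeff_map, coeff_coeffMap, ← Algebra.smul_def, map_smul, smul_eq_mul]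

theorem totalDegree_coeffMap_le (μ : K →ₗ[k] k) (p : MvPolynomial σ K) :
    (coeffMap μ p).totalDegree ≤ p.totalDegree := by
  refine Finset.sup_mono fun d hd => ?_
  rw [mem_support_iff, coeff_coeffMap] at hd
  exact mem_support_iff.mpr fun h => hd (by rw [h, map_zero])

theorem exists_coeffMap_ne_zero {p : MvPolynomial σ K} (hp : p ≠ 0) :
    ∃ μ : K →ₗ[k] k, coeffMap μ p ≠ 0 := by
  obtain ⟨d, hd⟩ := exists_coeff_ne_zero hp
  obtain ⟨μ, hμ⟩ := not_forall.mp
    (mt (Module.forall_dual_apply_eq_zero_iff k (coeff d p)).mp hd)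
  exact ⟨μ, fun h => hμ (by rw [← coeff_coeffMap, h, coeff_zero])⟩

theorem IsHomogeneous.coeffMap {p : MvPolynomial σ K} {n : ℕ} (hp : p.IsHomogeneous n)
    (μ : K →ₗ[k] k) : (coeffMap μ p).IsHomogeneous n := by
  refine IsHomogeneous.sum _ _ _ fun d hd => isHomogeneous_monomial _ ?_
  by_contra h
  exact (mem_support_iff.mp hd) (hp.coeff_eq_zero h)

theorem totalDegree_pos_of_not_isUnit {p : MvPolynomial σ K} (hp : ¬ IsUnit p) (h0 : p ≠ 0) :
    0 < p.totalDegree := by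
  rw [Nat.pos_iff_ne_zero]
  intro h
  rw [totalDegree_eq_zero_iff_eq_C] at h
  rw [h] at hp h0
  exact hp ((isUnit_iff_ne_zero.mpr fun hc => h0 (by rw [hc, C_0])).map C)

/-- Polynomials over `k` that have a common factor with the irreducible polynomial `F` over an
extension field are divisible by `F`. -/
theorem dvd_of_dvd_map {F y : MvPolynomial σ k} (hF : Irreducible F) {p : MvPolynomial σ K}
    (hp : ¬ IsUnit p) (hpF : p ∣ map (algebraMap k K) F) (hpy : p ∣ map (algebraMap k K) y) :
    F ∣ y := by
  obtain ⟨h, hh⟩ := hpF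
  obtain ⟨g, hg⟩ := hpy
  have hF0 : map (algebraMap k K) F ≠ 0 :=
    (map_ne_zero_iff _ (map_injective _ (algebraMap k K).injective)).mpr hF.ne_zero
  have hp0 : p ≠ 0 := left_ne_zero_of_mul (hh ▸ hF0)
  have hh0 : h ≠ 0 := right_ne_zero_of_mul (hh ▸ hF0)
  obtain ⟨μ, hμ⟩ := exists_coeffMap_ne_zero (k := k) hh0
  -- Over `K`, `F = p h` and `y = p g` give `F g = y h`. The functional brings this down to `k`,
  -- where `F` is prime and too large in degree to divide `coeffMap μ h`.
  have h1 : F * coeffMap μ g = y * coeffMap μ h := by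
    rw [← coeffMap_map_mul, ← coeffMap_map_mul, hh, hg]
    congr 1
    ring
  refine (hF.prime.dvd_or_dvd ⟨_, h1.symm⟩).resolve_right ?_
  rintro ⟨r, hr⟩
  have h2 := totalDegree_coeffMap_le μ h
  rw [hr, totalDegree_mul_of_isDomain (left_ne_zero_of_mul (hr ▸ hμ))
    (right_ne_zero_of_mul (hr ▸ hμ))] at h2
  have h3 := congrArg totalDegree hh
  rw [totalDegree_mul_of_isDomain hp0 hh0, totalDegree,
    support_map_of_injective _ (algebraMap k K).injective, ← totalDegree] at h3
  have := totalDegree_pos_of_not_isUnit hp hp0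
  omega

end CoeffMap

section Conjugates

variable {σ k K : Type*} [Field k] [Field K] [Algebra k K] [IsAlgClosure k K]

/-- All roots of the minimal polynomial are conjugate to `x`, hence equal to it, so the separable
degree is one. -/
theorem mem_perfectClosure_of_forall_algEquiv {x : K} (h : ∀ τ : K ≃ₐ[k] K, τ x = x) :
    x ∈ perfectClosure k K := by
  classical
  have : Normal k K := IsAlgClosure.normal k K
  have : IsAlgClosed K := IsAlgClosure.isAlgClosed k
  have hx : IsAlgebraic k x := Algebra.IsAlgebraic.isAlgebraic x
  rw [mem_perfectClosure_iff_natSepDegree_eq_one,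
    Polynomial.natSepDegree_eq_of_isAlgClosed (E := K)]
  have : ((minpoly k x).aroots K).toFinset = {x} := by
    ext y
    rw [Multiset.mem_toFinset, Polynomial.mem_aroots, Finset.mem_singleton]
    constructor
    · rintro ⟨-, hy⟩
      obtain ⟨τ, hτ⟩ := minpoly.exists_algEquiv_of_root' hx hy
      rw [← hτ, h]
    · rintro rfl
      exact ⟨minpoly.ne_zero hx.isIntegral, minpoly.aeval _ _⟩
  rw [this, Finset.card_singleton]

/-- The coefficients are fixed by all automorphisms, hence purely inseparable over `k`. A common
power of Frobenius brings all of them into `k`; the exponential characteristic covers characteristic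
zero as well. -/
theorem exists_pow_mem_range_map {N : MvPolynomial σ K}
    (hN : ∀ τ : K ≃ₐ[k] K, map (τ : K →+* K) N = N) :
    ∃ m ≠ 0, ∃ y : MvPolynomial σ k, map (algebraMap k K) y = N ^ m := by
  have : ExpChar k (ringExpChar k) := inferInstance
  have : ExpChar K (ringExpChar k) :=
    expChar_of_injective_algebraMap (algebraMap k K).injective (ringExpChar k)
  have hc : ∀ d, ∃ n : ℕ, coeff d N ^ ringExpChar k ^ n ∈ (algebraMap k K).range := fun d =>
    mem_perfectClosure_iff.mp (mem_perfectClosure_of_forall_algEquiv fun τ => by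
      conv_rhs => rw [← hN τ, coeff_map]
      rfl)
  choose n hn using hc
  let e := N.support.sup n
  refine ⟨ringExpChar k ^ e, pow_ne_zero _ (expChar_pos k (ringExpChar k)).ne', ?_⟩
  suffices h : N ^ ringExpChar k ^ e ∈ (map (σ := σ) (algebraMap k K)).range from h
  rw [← map_iterateFrobenius_expand]
  suffices h : map (iterateFrobenius K (ringExpChar k) e) (expand (ringExpChar k ^ e)
      (∑ d ∈ N.support, monomial d (coeff d N))) ∈ (map (σ := σ) (algebraMap k K)).range by
    rwa [support_sum_monomial_coeff] at h
  rw [map_sum, map_sum]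
  refine Subring.sum_mem _ fun d hd => ?_
  rw [expand_monomial, map_monomial]
  obtain ⟨j, hj⟩ := Nat.exists_eq_add_of_le (Finset.le_sup hd : n d ≤ e)
  obtain ⟨z, hz⟩ := hn d
  refine ⟨monomial (ringExpChar k ^ e • d) (z ^ ringExpChar k ^ j), ?_⟩
  rw [map_monomial, map_pow, hz, iterateFrobenius_def, ← pow_mul, ← pow_add, ← hj]

/-- The irreducible factors over the algebraic closure of an irreducible polynomial are conjugate
up to units. -/
theorem exists_algEquiv_associated {F : MvPolynomial σ k} (hF : Irreducible F)
    {p q : MvPolynomial σ K} (hp : Irreducible p) (hpF : p ∣ map (algebraMap k K) F)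
    (hq : Irreducible q) (hqF : q ∣ map (algebraMap k K) F) :
    ∃ τ : K ≃ₐ[k] K, Associated q (map (τ : K →+* K) p) := by
  classical
  have hF0 : map (algebraMap k K) F ≠ 0 :=
    (map_ne_zero_iff _ (map_injective _ (algebraMap k K).injective)).mpr hF.ne_zero
  obtain ⟨d, hd⟩ := exists_coeff_ne_zero hp.ne_zero
  -- With one coefficient scaled to `1`, associated conjugates are equal; as all of them divide `F`,
  -- there are finitely many.
  set u : K := (coeff d p)⁻¹ with hu
  have hu0 : u ≠ 0 := inv_ne_zero hd
  have hass : Associated p (C u * p) :=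
    (associated_unit_mul_left p (C u) ((isUnit_iff_ne_zero.mpr hu0).map C)).symm
  let P : (K ≃ₐ[k] K) → MvPolynomial σ K := fun τ => map (τ : K →+* K) (C u * p)
  have hPcoeff : ∀ τ, coeff d (P τ) = 1 := fun τ => by
    simp [P, coeff_map, coeff_C_mul, hu, hd]
  have hmapF : ∀ τ : K ≃ₐ[k] K,
      map (τ : K →+* K) (map (algebraMap k K) F) = map (algebraMap k K) F := fun τ => by
    rw [map_map]
    congr 2
    ext x
    exact τ.commutes x
  have hPirr : ∀ τ, Irreducible (P τ) := fun τ =>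
    (MulEquiv.irreducible_iff (mapEquiv σ (τ : K ≃+* K))).mpr (hass.irreducible hp)
  have hPF : ∀ τ, P τ ∣ map (algebraMap k K) F := fun τ => by
    rw [← hmapF τ]
    exact map_dvd _ (hass.symm.dvd.trans hpF)
  have heq : ∀ τ τ', Associated (P τ) (P τ') → P τ = P τ' := by
    rintro τ τ' ⟨w, hw⟩
    obtain ⟨r, hr⟩ := isUnit_iff_eq_C_of_isReduced.mp w.isUnit
    have h1 := congrArg (coeff d) hw
    rw [hr.2, mul_comm, coeff_C_mul, hPcoeff, hPcoeff, mul_one] at h1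
    rw [← hw, hr.2, h1, C_1, mul_one]
  have hfin : (Set.range P).Finite := by
    choose g hg hg' using fun τ =>
      UniqueFactorizationMonoid.exists_mem_factors_of_dvd hF0 (hPirr τ) (hPF τ)
    refine Set.Finite.of_finite_image (f := fun x => Associates.mk x) ?_ ?_
    · refine (Finset.finite_toSet
        (((UniqueFactorizationMonoid.factors (map (algebraMap k K) F)).map
          Associates.mk).toFinset)).subset ?_
      rintro _ ⟨_, ⟨τ, rfl⟩, rfl⟩
      rw [Finset.mem_coe, Multiset.mem_toFinset, Multiset.mem_map]
      exact ⟨g τ, hg τ, (Associates.mk_eq_mk_iff_associated.mpr (hg' τ)).symm⟩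
    · rintro _ ⟨τ, rfl⟩ _ ⟨τ', rfl⟩ h
      exact heq τ τ' (Associates.mk_eq_mk_iff_associated.mp h)
  -- The product of the conjugates is Galois invariant, so a power of it comes from some `y` over
  -- `k`. As `F` shares the factor `P 1` with `y`, it divides `y`; hence `q` divides a power of `N`,
  -- and so a conjugate of `p`.
  let N : MvPolynomial σ K := ∏ r ∈ hfin.toFinset, r
  have hN : ∀ τ : K ≃ₐ[k] K, map (τ : K →+* K) N = N := by
    intro τ
    have himg : hfin.toFinset.image (map (τ : K →+* K)) = hfin.toFinset := by
      ext r
      simp only [Finset.mem_image, Set.Finite.mem_toFinset, Set.mem_range]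
      constructor
      · rintro ⟨_, ⟨ρ, rfl⟩, rfl⟩
        refine ⟨τ * ρ, ?_⟩
        simp only [P]
        rw [map_map]
        rfl
      · rintro ⟨ρ, rfl⟩
        refine ⟨_, ⟨τ⁻¹ * ρ, rfl⟩, ?_⟩
        simp only [P]
        rw [map_map]
        congr 2
        ext x
        exact τ.apply_symm_apply (ρ x)
    have := Finset.prod_image (s := hfin.toFinset) (g := map (τ : K →+* K)) (f := id)
      (map_injective _ (τ : K →+* K).injective).injOn
    rw [himg] at this
    simp only [N, map_prod]
    exact this.symm
  obtain ⟨m, hm, y, hy⟩ := exists_pow_mem_range_map hN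
  have hPN : P 1 ∣ N := Finset.dvd_prod_of_mem _ (hfin.mem_toFinset.mpr ⟨1, rfl⟩)
  have hFy : F ∣ y := dvd_of_dvd_map hF (hPirr 1).not_isUnit (hPF 1)
    (hy ▸ hPN.trans (dvd_pow_self N hm))
  have hqN : q ∣ N := hq.prime.dvd_of_dvd_pow (hy ▸ hqF.trans (map_dvd _ hFy))
  obtain ⟨r, hr, hqr⟩ := (hq.prime.dvd_finsetProd_iff _).mp hqN
  obtain ⟨τ, rfl⟩ := hfin.mem_toFinset.mp hr
  refine ⟨τ, (hq.associated_of_dvd (hPirr τ) hqr).trans ?_⟩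
  exact (hass.map (map (τ : K →+* K))).symm

end Conjugates

end MvPolynomial

/-! ### The rational singular points -/

namespace MvPolynomial

section

variable {σ k K : Type*} [Field k] [Field K] [Algebra k K]

theorem eval_map_comp {R S : Type*} [CommRing R] [CommRing S] (φ : R →+* S) (p : MvPolynomial σ R)
    (w : σ → R) : MvPolynomial.eval (fun i => φ (w i)) (map φ p) = φ (MvPolynomial.eval w p) := by
  induction p using MvPolynomial.induction_on with
  | C a => simp
  | add p q hp hq => simp only [map_add, hp, hq]
  | mul_X p i hp => simp only [map_mul, map_X, eval_X, hp]

theorem eval_coeffMap (μ : K →ₗ[k] k) (p : MvPolynomial σ K) (w : σ → k) :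
    eval w (coeffMap μ p) = μ (eval (fun i => algebraMap k K (w i)) p) := by
  rw [coeffMap, map_sum, eval_eq, map_sum]
  refine Finset.sum_congr rfl fun d _ => ?_
  rw [eval_monomial, mul_comm (coeff d p)]
  simp only [← map_pow, ← map_prod]
  rw [← Algebra.smul_def, map_smul, smul_eq_mul, mul_comm]
  rfl

theorem exists_pow_eq_of_forall_dvd {σ : Type*} {K : Type*} [Field K] (p : ℕ) [ExpChar K p]
    [PerfectRing K p] {F : MvPolynomial σ K} (h : ∀ d ∈ F.support, ∀ i, p ∣ d i) :
    ∃ H : MvPolynomial σ K, H ^ p = F := by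
  have hp : p ≠ 0 := (expChar_pos K p).ne'
  let H : MvPolynomial σ K := ∑ d ∈ F.support,
    monomial (d.mapRange (· / p) (Nat.zero_div p)) ((frobeniusEquiv K p).symm (coeff d F))
  refine ⟨H, ?_⟩
  conv_rhs => rw [← support_sum_monomial_coeff F]
  have : ExpChar (MvPolynomial σ K) p := inferInstance
  rw [sum_pow_char]
  refine Finset.sum_congr rfl fun d hd => ?_
  have h1 : p • d.mapRange (· / p) (Nat.zero_div p) = d := by
    ext i
    simp [Nat.mul_div_cancel' (h d hd i)]
  rw [monomial_pow, h1]
  exact congrArg (monomial d) ((frobeniusEquiv K p).apply_symm_apply (coeff d F))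

theorem IsHomogeneous.of_pow {σ R : Type*} [CommRing R] [IsDomain R] {H : MvPolynomial σ R}
    {m n : ℕ} (hm : m ≠ 0) (h0 : H ≠ 0) (h : (H ^ m).IsHomogeneous n) :
    H.IsHomogeneous H.totalDegree ∧ H.totalDegree * m = n := by
  have h1 := h.of_dvd (pow_ne_zero m h0) (dvd_pow_self H hm)
  exact ⟨h1, (h1.pow m).inj_right h (pow_ne_zero m h0)⟩

end

end MvPolynomial

namespace PlaneCurve

open MvPolynomial

section RationalSingularPoints

variable {k : Type u} [Field k] {F : MvPolynomial (Fin 3) k} {f : ℕ}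

theorem degree_ne_zero_of_irreducible (hF : F.IsHomogeneous f) (hirr : Irreducible F) : f ≠ 0 := by
  rw [← hF.totalDegree hirr.ne_zero]
  exact (totalDegree_pos_of_not_isUnit hirr.not_isUnit hirr.ne_zero).ne'

theorem dvd_of_pderiv_eq_zero {σ : Type*} (p : ℕ) [CharP k p] {F : MvPolynomial σ k}
    (h : ∀ i, pderiv i F = 0) (d : σ →₀ ℕ) (hd : d ∈ F.support) (i : σ) : p ∣ d i := by
  classical
  by_cases hdi : d i = 0
  · rw [hdi]; exact dvd_zero p
  have h1 := congrArg (coeff (d - Finsupp.single i 1)) (h i)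
  have h2 : d - Finsupp.single i 1 + Finsupp.single i 1 = d :=
    tsub_add_cancel_of_le (by simpa [Nat.one_le_iff_ne_zero] using hdi)
  rw [coeff_pderiv, h2, coeff_zero] at h1
  rw [← CharP.cast_eq_zero_iff k p]
  have h3 := (mul_eq_zero.mp h1).resolve_left (mem_support_iff.mp hd)
  have h4 : ((d - Finsupp.single i 1 : σ →₀ ℕ) i) + 1 = d i := by
    simp; omega
  rw [← h4]
  exact_mod_cast h3

/-- The rational singular points of an irreducible curve lie on a curve of smaller degree. -/
theorem exists_form_of_singular (hF : F.IsHomogeneous f) (hirr : Irreducible F) :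
    ∃ (G : MvPolynomial (Fin 3) k) (b : ℕ), G.IsHomogeneous b ∧ G ≠ 0 ∧ IsRelPrime F G ∧
      ∀ w, IsSingularAt F w → eval w G = 0 := by
  have hf := degree_ne_zero_of_irreducible hF hirr
  by_cases hder : ∀ i, pderiv i F = 0
  · obtain ⟨p, hp⟩ := CharP.exists k
    have hdvd := dvd_of_pderiv_eq_zero p hder
    rcases CharP.char_is_prime_or_zero k p with hprime | rfl
    · have : Fact p.Prime := ⟨hprime⟩
      let K := AlgebraicClosure k
      have : CharP K p := charP_of_injective_algebraMap (algebraMap k K).injective p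
      have hFK0 : geom F ≠ 0 :=
        (map_ne_zero_iff _ (map_injective _ (algebraMap k K).injective)).mpr hirr.ne_zero
      -- When all partial derivatives vanish identically, `F` is a `p`-th power `H ^ p` over the
      -- closure. At rational zeros of `F` also `H` vanishes, and a functional applied to its
      -- coefficients gives a form over `k` of degree `f / p`.
      obtain ⟨H, hH⟩ := exists_pow_eq_of_forall_dvd p (F := geom F) (by
        intro d hd
        rw [geom, support_map_of_injective _ (algebraMap k K).injective] at hd
        exact hdvd d hd)
      have hH0 : H ≠ 0 := by
        rintro rfl
        exact hFK0 (by rw [← hH, zero_pow hprime.ne_zero])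
      obtain ⟨hHhom, hHdeg⟩ := IsHomogeneous.of_pow hprime.ne_zero hH0
        (n := f) (by rw [hH]; exact hF.map _)
      obtain ⟨μ, hμ⟩ := exists_coeffMap_ne_zero (k := k) hH0
      refine ⟨coeffMap μ H, _, hHhom.coeffMap μ, hμ, ?_, fun w hw => ?_⟩
      · refine hirr.isRelPrime_iff_not_dvd.mpr (hF.not_dvd_of_lt (totalDegree_coeffMap_le μ H) hμ ?_)
        rw [← hHdeg]
        refine lt_mul_of_one_lt_right (Nat.pos_of_ne_zero ?_) hprime.one_lt
        intro h0
        rw [h0, zero_mul] at hHdeg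
        exact hf hHdeg.symm
      · rw [eval_coeffMap]
        have : eval (fun i => algebraMap k K (w i)) H ^ p = 0 := by
          rw [← map_pow, hH, geom, eval_map_comp, hw.2.1, map_zero]
        rw [eq_zero_of_pow_eq_zero this, map_zero]
    -- In characteristic zero all exponents would be zero, and `F` constant.
    · exfalso
      obtain ⟨d, hd⟩ := exists_coeff_ne_zero hirr.ne_zero
      have hd0 : d = 0 := Finsupp.ext fun i =>
        Nat.eq_zero_of_zero_dvd (hdvd d (mem_support_iff.mpr hd) i)
      apply hd
      apply hF.coeff_eq_zero
      simpa [hd0] using hf.symm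
  · obtain ⟨i, hi⟩ := not_forall.mp hder
    refine ⟨pderiv i F, f - 1, hF.pderiv, hi, ?_, fun w hw => hw.2.2 i⟩
    exact hirr.isRelPrime_iff_not_dvd.mpr
      (hF.not_dvd_of_lt hF.pderiv.totalDegree_le hi (by omega))

/-- Bézout's bound applied over `k` to `F` and the form of `exists_form_of_singular`. Thus the set
is finite even when the curve over the closure is not reduced. -/
theorem finite_rationalSingularPoints (hF : F.IsHomogeneous f) (hirr : Irreducible F) :
    (rationalSingularPoints hF).Finite := by
  obtain ⟨G, b, hG, hG0, hrel, hGw⟩ := exists_form_of_singular hF hirr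
  by_contra hinf
  obtain ⟨T, hTS, hT⟩ := Set.Infinite.exists_subset_card_eq hinf (f * b + 1)
  choose! w hw using fun (x : geomCurve hF) (hx : x ∈ rationalSingularPoints hF) => hx
  let e := (T.equivFin.trans (finCongr hT)).symm
  have hmem : ∀ i, (e i : geomCurve hF) ∈ rationalSingularPoints hF := fun i => hTS (e i).2
  have := card_commonZeros_le hF hG hG0 hrel (fun i => w (e i))
    (fun i => (hw _ (hmem i)).1.1) ?_ (fun i => (hw _ (hmem i)).1.2.1)
    (fun i => hGw _ (hw _ (hmem i)).1)
  · omega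
  intro i j hij c hc
  have hc0 : c ≠ 0 := by
    rintro rfl
    exact (hw _ (hmem i)).1.1 (by rw [hc, zero_smul])
  apply hij
  apply e.injective
  apply Subtype.ext
  refine (IsPointAt.eq_of_smul (hF.map _) (c := algebraMap k _ c)
    ((map_ne_zero_iff _ (algebraMap k (AlgebraicClosure k)).injective).mpr hc0)
    (hw _ (hmem j)).2 ?_).symm
  have h1 := (hw _ (hmem i)).2
  rw [hc] at h1
  convert h1 using 1
  ext i
  simp

/-- A finite set of closed points is closed, so `complOpen` removes exactly the `k`-singularities.
-/
theorem closure_rationalSingularPoints (hF : F.IsHomogeneous f) (hirr : Irreducible F) :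
    closure (rationalSingularPoints hF) = rationalSingularPoints hF := by
  refine IsClosed.closure_eq ?_
  rw [← Set.biUnion_of_singleton (rationalSingularPoints hF)]
  refine (finite_rationalSingularPoints hF hirr).isClosed_biUnion fun x hx => ?_
  obtain ⟨w, hw, hx⟩ := hx
  refine isClosed_of_closure_subset fun y hy => ?_
  exact (hx.eq_of_specializes (hF.map _) (specializes_iff_mem_closure.mpr hy)).symm

end RationalSingularPoints

end PlaneCurve

/-! ### Balanced factorizations over the algebraic closure -/

/-- An equivalence relation that is preserved by a transitive family of injective maps has classes
of equal size, so that one can choose about half of the elements as a union of classes. -/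
theorem Setoid.exists_saturated_half {ι : Type*} [Fintype ι] (s : Setoid ι)
    (h : ∀ i j, ∃ π : ι → ι, Function.Injective π ∧ π i = j ∧ ∀ x y, s x y → s (π x) (π y)) :
    ∃ (c : ℕ) (T : Finset ι), Fintype.card ι = c * Nat.card (Quotient s) ∧
      T.card = c * (Nat.card (Quotient s) / 2) ∧ ∀ i j, s i j → i ∈ T → j ∈ T := by
  classical
  let cl : ι → Finset ι := fun i => Finset.univ.filter (s i)
  -- The map `π` carries the class of `i` injectively into the class of `π i`.
  have hle : ∀ i j, (cl i).card ≤ (cl j).card := by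
    intro i j
    obtain ⟨π, hπ, rfl, hs⟩ := h i j
    refine Finset.card_le_card_of_injOn π (fun x hx => ?_) hπ.injOn
    simp only [cl, Finset.coe_filter, Finset.mem_univ, true_and, Set.mem_ofPred_eq] at hx ⊢
    exact hs _ _ hx
  obtain ⟨c, hc⟩ : ∃ c, ∀ i, (cl i).card = c := by
    rcases isEmpty_or_nonempty ι with hι | ⟨⟨i₀⟩⟩
    · exact ⟨0, fun i => hι.elim i⟩
    · exact ⟨(cl i₀).card, fun i => le_antisymm (hle _ _) (hle _ _)⟩
  have hcard : ∀ Q : Finset (Quotient s),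
      (Finset.univ.filter fun i : ι => Quotient.mk s i ∈ Q).card = c * Q.card := by
    intro Q
    rw [Finset.card_eq_sum_card_fiberwise (f := Quotient.mk s) (t := Q)
      (fun x hx => by simpa using hx), Finset.sum_const_nat (m := c), mul_comm]
    intro q hq
    induction q using Quotient.inductionOn with
    | h i =>
      rw [← hc i]
      congr 1
      ext x
      simp only [cl, Finset.mem_filter, Finset.mem_univ, true_and]
      constructor
      · rintro ⟨-, hx⟩
        exact s.symm (Quotient.exact hx)
      · intro hx
        have : Quotient.mk s x = Quotient.mk s i := Quotient.sound (s.symm hx)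
        exact ⟨this ▸ hq, this⟩
  obtain ⟨Q, -, hQ⟩ := Finset.exists_subset_card_eq
    (s := (Finset.univ : Finset (Quotient s))) (n := Fintype.card (Quotient s) / 2)
    (by rw [Finset.card_univ]; omega)
  refine ⟨c, Finset.univ.filter fun i : ι => Quotient.mk s i ∈ Q, ?_, ?_, ?_⟩
  · have := hcard Finset.univ
    simpa using this
  · rw [hcard, hQ, Nat.card_eq_fintype_card]
  · intro i j hij hi
    simp only [Finset.mem_filter, Finset.mem_univ, true_and] at hi ⊢
    rwa [← show Quotient.mk s i = Quotient.mk s j from Quotient.sound hij]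

namespace PlaneCurve

open MvPolynomial

section Factorization

variable {k : Type u} [Field k] {F : MvPolynomial (Fin 3) k} {f : ℕ}

theorem map_geom (F : MvPolynomial (Fin 3) k) (τ : AlgebraicClosure k ≃ₐ[k] AlgebraicClosure k) :
    map (τ : AlgebraicClosure k →+* AlgebraicClosure k) (geom F) = geom F := by
  rw [geom, map_map]
  congr 2
  ext x
  exact τ.commutes x

theorem totalDegree_eq_of_associated {σ K : Type*} [Field K] {p q : MvPolynomial σ K}
    (h : Associated p q) (hp : p ≠ 0) : p.totalDegree = q.totalDegree := by
  have h1 := totalDegree_le_of_dvd_of_isDomain h.dvd (h.ne_zero_iff.mp hp)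
  have h2 := totalDegree_le_of_dvd_of_isDomain h.symm.dvd hp
  exact le_antisymm h1 h2

theorem geom_ne_zero (hF0 : F ≠ 0) : geom F ≠ 0 :=
  (map_ne_zero_iff _ (map_injective _ (algebraMap k (AlgebraicClosure k)).injective)).mpr hF0

/-- Let `Z` be a Galois stable set of vectors. Either the irreducible factors of `F` over the
algebraic closure are linked by common zeros outside `Z`, or `F` has a factorization
into coprime factors, of about equal degrees, whose common zeros lie in `Z`. -/
theorem exists_balanced_factorization (hF : F.IsHomogeneous f) (hirr : Irreducible F)
    (Z : Set (Fin 3 → AlgebraicClosure k))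
    (hZ : ∀ (τ : AlgebraicClosure k ≃ₐ[k] AlgebraicClosure k), ∀ v ∈ Z, (fun i => τ (v i)) ∈ Z) :
    (∃ (D E : MvPolynomial (Fin 3) (AlgebraicClosure k)) (a b n e : ℕ), geom F = D * E ∧
      D.IsHomogeneous a ∧ E.IsHomogeneous b ∧ IsRelPrime D E ∧
      (∀ v ≠ 0, eval v D = 0 → eval v E = 0 → v ∈ Z) ∧
      2 ≤ n ∧ e * n = f ∧ a = e * (n / 2) ∧ a + b = f) ∨
    (∀ W : MvPolynomial (Fin 3) (AlgebraicClosure k) → Prop,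
      (∀ p q, Irreducible p → Irreducible q → p ∣ geom F → q ∣ geom F →
        (Associated p q ∨ ∃ v ≠ 0, v ∉ Z ∧ eval v p = 0 ∧ eval v q = 0) → (W p → W q)) →
      ∀ p q, Irreducible p → Irreducible q → p ∣ geom F → q ∣ geom F → W p → W q) := by
  classical
  let := UniqueFactorizationMonoid.strongNormalizationMonoid
    (α := MvPolynomial (Fin 3) (AlgebraicClosure k))
  have hF0 := geom_ne_zero hirr.ne_zero
  set nf := UniqueFactorizationMonoid.normalizedFactors (geom F) with hnf
  let ι := {q // q ∈ nf.toFinset}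
  have hmem : ∀ i : ι, i.1 ∈ nf := fun i => Multiset.mem_toFinset.mp i.2
  have hιirr : ∀ i : ι, Irreducible i.1 := fun i =>
    UniqueFactorizationMonoid.irreducible_of_normalized_factor _ (hmem i)
  have hιdvd : ∀ i : ι, i.1 ∣ geom F := fun i =>
    UniqueFactorizationMonoid.dvd_of_mem_normalizedFactors (hmem i)
  have hιex : ∀ p, Irreducible p → p ∣ geom F → ∃ i : ι, Associated p i.1 := by
    intro p hp hpF
    obtain ⟨q, hq, hpq⟩ := UniqueFactorizationMonoid.exists_mem_normalizedFactors_of_dvd hF0 hp hpF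
    exact ⟨⟨q, Multiset.mem_toFinset.mpr hq⟩, hpq⟩
  have hιeq : ∀ i j : ι, Associated i.1 j.1 → i = j := by
    intro i j h
    refine Subtype.ext ?_
    rw [← UniqueFactorizationMonoid.normalize_normalized_factor _ (hmem i),
      ← UniqueFactorizationMonoid.normalize_normalized_factor _ (hmem j)]
    exact normalize_eq_normalize_iff_associated.mpr h
  -- Linkage of factors; `s` is the equivalence relation that it generates.
  let r : ι → ι → Prop := fun i j => ∃ v ≠ 0, v ∉ Z ∧ eval v i.1 = 0 ∧ eval v j.1 = 0
  let s : Setoid ι := Relation.EqvGen.setoid r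
  by_cases hconn : ∀ i j, s i j
  · right
    intro W hW p q hp hq hpF hqF hWp
    obtain ⟨i, hi⟩ := hιex p hp hpF
    obtain ⟨j, hj⟩ := hιex q hq hqF
    have hWij : ∀ i j, s i j → (W i.1 ↔ W j.1) := by
      intro i j hij
      induction hij with
      | rel x y h =>
        obtain ⟨v, hv, hvZ, hx, hy⟩ := h
        exact ⟨hW _ _ (hιirr x) (hιirr y) (hιdvd x) (hιdvd y) (Or.inr ⟨v, hv, hvZ, hx, hy⟩),
          hW _ _ (hιirr y) (hιirr x) (hιdvd y) (hιdvd x) (Or.inr ⟨v, hv, hvZ, hy, hx⟩)⟩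
      | refl x => exact Iff.rfl
      | symm x y _ ih => exact ih.symm
      | trans x y z _ _ ih1 ih2 => exact ih1.trans ih2
    have h1 := hW _ _ hp (hιirr i) hpF (hιdvd i) (Or.inl hi) hWp
    exact hW _ _ (hιirr j) hq (hιdvd j) hqF (Or.inl hj.symm) ((hWij i j (hconn i j)).mp h1)
  left
  have hmapirr : ∀ (τ : AlgebraicClosure k ≃ₐ[k] AlgebraicClosure k) {p}, Irreducible p →
      Irreducible (map (τ : AlgebraicClosure k →+* AlgebraicClosure k) p) := fun τ _ hp =>
    (MulEquiv.irreducible_iff (mapEquiv (Fin 3)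
      (τ : AlgebraicClosure k ≃+* AlgebraicClosure k))).mpr hp
  have hmapdvd : ∀ (τ : AlgebraicClosure k ≃ₐ[k] AlgebraicClosure k) {p}, p ∣ geom F →
      map (τ : AlgebraicClosure k →+* AlgebraicClosure k) p ∣ geom F := fun τ p hp => by
    rw [← map_geom F τ]
    exact map_dvd _ hp
  have hperm : ∀ τ : AlgebraicClosure k ≃ₐ[k] AlgebraicClosure k, ∃ π : ι → ι,
      ∀ i, Associated (map (τ : AlgebraicClosure k →+* AlgebraicClosure k) i.1) (π i).1 := fun τ =>
    Classical.axiomOfChoice fun i => hιex _ (hmapirr τ (hιirr i)) (hmapdvd τ (hιdvd i))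
  have htrans : ∀ i j : ι, ∃ τ : AlgebraicClosure k ≃ₐ[k] AlgebraicClosure k,
      Associated j.1 (map (τ : AlgebraicClosure k →+* AlgebraicClosure k) i.1) := fun i j =>
    exists_algEquiv_associated hirr (hιirr i) (hιdvd i) (hιirr j) (hιdvd j)
  have hr : ∀ (τ : AlgebraicClosure k ≃ₐ[k] AlgebraicClosure k) (π : ι → ι),
      (∀ i, Associated (map (τ : AlgebraicClosure k →+* AlgebraicClosure k) i.1) (π i).1) →
      ∀ x y, r x y → r (π x) (π y) := by
    rintro τ π hπ x y ⟨v, hv, hvZ, hx, hy⟩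
    have hz : ∀ i : ι, eval v i.1 = 0 → eval (fun j => τ (v j)) (π i).1 = 0 := by
      intro i hi
      obtain ⟨w, hw⟩ := hπ i
      rw [← hw, map_mul]
      have := eval_map_comp (τ : AlgebraicClosure k →+* AlgebraicClosure k) i.1 v
      rw [hi, map_zero] at this
      rw [show (fun j => τ (v j)) =
        fun j => (τ : AlgebraicClosure k →+* AlgebraicClosure k) (v j) from rfl, this, zero_mul]
    refine ⟨fun j => τ (v j), fun h0 => hv ?_, fun hvZ' => hvZ ?_, hz x hx, hz y hy⟩
    · ext j
      exact (map_eq_zero_iff τ τ.injective).mp (congrFun h0 j)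
    · simpa using hZ τ.symm _ hvZ'
  -- The automorphisms permute the factors transitively and, since `Z` is stable, preserve linkage.
  obtain ⟨c, T, hcard, hT, hsat⟩ := s.exists_saturated_half (by
    intro i j
    obtain ⟨τ, hτ⟩ := htrans i j
    obtain ⟨π, hπ⟩ := hperm τ
    refine ⟨π, fun x y hxy => ?_, hιeq _ _ ((hτ.trans (hπ i)).symm), fun x y hxy => ?_⟩
    · apply hιeq
      have h1 := (hπ x).trans (hxy ▸ (hπ y).symm)
      have h2 := h1.map (map ((τ.symm : AlgebraicClosure k ≃ₐ[k] AlgebraicClosure k) :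
        AlgebraicClosure k →+* AlgebraicClosure k))
      rw [map_map, map_map] at h2
      have h3 : ((τ.symm : AlgebraicClosure k ≃ₐ[k] AlgebraicClosure k) :
          AlgebraicClosure k →+* AlgebraicClosure k).comp
          (τ : AlgebraicClosure k →+* AlgebraicClosure k) = RingHom.id _ := by
        ext z
        exact τ.symm_apply_apply z
      simpa only [h3, MvPolynomial.map_id, RingHom.id_apply] using h2
    · induction hxy with
      | rel x y h => exact Relation.EqvGen.rel _ _ (hr τ π hπ x y h)
      | refl x => exact Relation.EqvGen.refl _
      | symm x y _ ih => exact Relation.EqvGen.symm _ _ ih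
      | trans x y z _ _ ih1 ih2 => exact Relation.EqvGen.trans _ _ _ ih1 ih2)
  let m : ι → ℕ := fun i => nf.count i.1
  -- Conjugate factors have the same degree and the same multiplicity, so each contributes the same
  -- amount `w` to the degree `f`.
  obtain ⟨w, hw⟩ : ∃ w, ∀ i : ι, i.1.totalDegree * m i = w := by
    have key : ∀ i j : ι, i.1.totalDegree * m i = j.1.totalDegree * m j := by
      intro i j
      obtain ⟨τ, hτ⟩ := htrans i j
      congr 1
      · rw [totalDegree_eq_of_associated hτ (hιirr j).ne_zero, totalDegree, totalDegree,
          support_map_of_injective _ (τ : AlgebraicClosure k →+* AlgebraicClosure k).injective]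
      · have h1 : ∀ i : ι, emultiplicity i.1 (geom F) = m i := fun i => by
          rw [UniqueFactorizationMonoid.emultiplicity_eq_count_normalizedFactors (hιirr i) hF0,
            UniqueFactorizationMonoid.normalize_normalized_factor _ (hmem i)]
        have h2 : emultiplicity i.1 (geom F) = emultiplicity j.1 (geom F) := by
          have h3 : emultiplicity (map (τ : AlgebraicClosure k →+* AlgebraicClosure k) i.1)
              (map (τ : AlgebraicClosure k →+* AlgebraicClosure k) (geom F)) =
              emultiplicity i.1 (geom F) := emultiplicity_map_eq (mapEquiv (Fin 3)
            (τ : AlgebraicClosure k ≃+* AlgebraicClosure k))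
          rw [← h3, map_geom]
          exact emultiplicity_eq_of_associated_left hτ
        rw [h1, h1] at h2
        exact_mod_cast h2
    rcases isEmpty_or_nonempty ι with hι | ⟨⟨i₀⟩⟩
    · exact ⟨0, fun i => hι.elim i⟩
    · exact ⟨_, fun i => key i i₀⟩
  have hhom : ∀ U : Finset ι, (∏ i ∈ U, i.1 ^ m i).IsHomogeneous (w * U.card) := by
    intro U
    have := IsHomogeneous.prod U (fun i : ι => i.1 ^ m i) (fun _ => w) fun i _ => by
      have := ((hF.map _).of_dvd hF0 (hιdvd i)).pow (m i)
      rwa [hw] at this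
    simpa [mul_comm] using this
  obtain ⟨u, hu⟩ : Associated (∏ i : ι, i.1 ^ m i) (geom F) := by
    have h1 := UniqueFactorizationMonoid.prod_normalizedFactors hF0
    rw [← hnf, Finset.prod_multiset_count] at h1
    rwa [Finset.prod_coe_sort nf.toFinset fun q => q ^ nf.count q]
  have hsplit : (∏ i ∈ T, i.1 ^ m i) * (∏ i ∈ Tᶜ, i.1 ^ m i) = ∏ i : ι, i.1 ^ m i :=
    Finset.prod_mul_prod_compl T _
  obtain ⟨x, hx⟩ := isUnit_iff_eq_C_of_isReduced.mp u.isUnit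
  have hE : ((∏ i ∈ Tᶜ, i.1 ^ m i) * (u : MvPolynomial (Fin 3) (AlgebraicClosure k))).IsHomogeneous
      (w * Tᶜ.card) := by
    rw [hx.2]
    simpa using (hhom Tᶜ).mul (isHomogeneous_C (Fin 3) x)
  have hfac : geom F = (∏ i ∈ T, i.1 ^ m i) * ((∏ i ∈ Tᶜ, i.1 ^ m i) * u) := by
    rw [← mul_assoc, hsplit, hu]
  have hdeg : w * T.card + w * Tᶜ.card = f := by
    have h1 := (hhom T).mul hE
    rw [← hfac] at h1
    exact h1.inj_right (hF.map _) hF0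
  -- Each class has `c` members, so it contributes the degree `e = w * c`. The constant unit `u` is
  -- absorbed into the second factor.
  refine ⟨∏ i ∈ T, i.1 ^ m i, (∏ i ∈ Tᶜ, i.1 ^ m i) * u, _, _, Nat.card (Quotient s), w * c,
    hfac, hhom T, hE, ?_, ?_, ?_, ?_, ?_, hdeg⟩
  · refine IsRelPrime.prod_left fun i hi => IsRelPrime.mul_right (IsRelPrime.prod_right
      fun j hj => IsRelPrime.pow ?_) u.isUnit.isRelPrime_right
    refine (hιirr i).isRelPrime_iff_not_dvd.mpr fun hij => ?_
    have := hιeq i j ((hιirr i).associated_of_dvd (hιirr j) hij)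
    rw [Finset.mem_compl] at hj
    exact hj (this ▸ hi)
  · intro v hv hD hE
    rw [map_prod, Finset.prod_eq_zero_iff] at hD
    rw [map_mul, mul_eq_zero, or_iff_left, map_prod, Finset.prod_eq_zero_iff] at hE
    · obtain ⟨i, hi, hi0⟩ := hD
      obtain ⟨j, hj, hj0⟩ := hE
      rw [map_pow] at hi0 hj0
      by_contra hvZ
      -- A common zero outside `Z` would link a factor in `T` to one outside, although `T` is a
      -- union of classes.
      refine (Finset.mem_compl.mp hj) (hsat i j (Relation.EqvGen.rel _ _ ⟨v, hv, hvZ, ?_, ?_⟩) hi)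
      · exact eq_zero_of_pow_eq_zero hi0
      · exact eq_zero_of_pow_eq_zero hj0
    · exact (u.isUnit.map (eval v)).ne_zero
  · push Not at hconn
    obtain ⟨i, j, hij⟩ := hconn
    have : Nontrivial (Quotient s) :=
      ⟨Quotient.mk s i, Quotient.mk s j, fun h => hij (Quotient.exact h)⟩
    exact Finite.one_lt_card
  · rw [mul_assoc, ← hcard, ← hdeg, ← mul_add, Finset.card_add_card_compl]
  · rw [hT, mul_assoc]

end Factorization

end PlaneCurve

/-! ### Connectedness of normalizations -/

namespace SchemeNormalization

theorem connectedSpace_genericScheme (X : Scheme.{u}) [IrreducibleSpace X] :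
    ConnectedSpace (genericScheme X) := by
  have hs : genericPoints X = {genericPoint X} := genericPoints_eq_singleton
  have : Unique (genericPoints X) := by
    rw [hs]
    infer_instance
  have h : Function.Surjective (coproductUniqueIso
      fun x : genericPoints X => Spec (X.residueField x.1)).inv :=
    Scheme.Hom.surjective _
  exact h.connectedSpace (Scheme.Hom.continuous _)

/-- The canonical map from `X` to the relative normalization has dense image, and the closure of a
connected set is connected. -/
theorem connectedSpace_normalization_of_connectedSpace {X Y : Scheme.{u}} (f : X ⟶ Y)
    [QuasiCompact f] [QuasiSeparated f] [ConnectedSpace X] : ConnectedSpace f.normalization := by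
  have h : DenseRange f.toNormalization := f.toNormalization.denseRange
  have h1 := h.preconnectedSpace (Scheme.Hom.continuous _)
  exact { toNonempty := ‹ConnectedSpace X›.toNonempty.map f.toNormalization }

end SchemeNormalization

/-! ### The numerical contradiction, and the components of `V(F)` -/

namespace PlaneCurve

open MvPolynomial

/-- A finite check, since `f ≤ 9` and `n` divides `f`. The margin is only one for `f = n = 7`, where
`4 + 3 * 4 > 15`, and for `f = 9`, `n = 3`, where `11 + 3 * 6 > 28`. -/
theorem CaseOfInterest.choose_lt {f g a b n e : ℕ} (h : CaseOfInterest f g) (hn : 2 ≤ n)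
    (hen : e * n = f) (ha : a = e * (n / 2)) (hab : a + b = f) (hf : f ≠ 0) :
    (f - 1).choose 2 < g + a * b := by
  have hf9 : f ≤ 9 := by rcases h with h | h | h <;> omega
  have hnf : n ≤ f := Nat.le_of_dvd (Nat.pos_of_ne_zero hf) ⟨e, by rw [← hen, mul_comm]⟩
  obtain rfl : e = f / n := (Nat.div_eq_of_eq_mul_left (by omega) hen.symm).symm
  obtain rfl : b = f - a := by omega
  clear hab
  subst ha
  unfold CaseOfInterest at h
  interval_cases f <;> interval_cases n <;>
    (simp only [Nat.choose]; omega)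

section Points

variable {K : Type u} [Field K] {F : MvPolynomial (Fin 3) K} {f : ℕ} (hF : F.IsHomogeneous f)

theorem IsPointAt.of_smul {x : curve hF} {v : Fin 3 → K} {c : K} (hc : c ≠ 0)
    (hx : IsPointAt hF x (c • v)) : IsPointAt hF x v := by
  rw [isPointAt_iff] at hx ⊢
  intro n G hG
  rw [hx n G hG, hG.eval_smul, mul_eq_zero, or_iff_right (pow_ne_zero n hc)]

theorem IsPointAt.exists_eq_smul {x : curve hF} {v w : Fin 3 → K} (hv : v ≠ 0) (hw : w ≠ 0)
    (hx : IsPointAt hF x v) (hy : IsPointAt hF x w) : ∃ c : K, c ≠ 0 ∧ v = c • w := by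
  rw [isPointAt_iff] at hx hy
  obtain ⟨i, hi⟩ := Function.ne_iff.mp hw
  have h : v = (v i / w i) • w := by
    ext j
    have hG : (C (w i) * X j - C (w j) * X i : MvPolynomial (Fin 3) K).IsHomogeneous 1 :=
      ((isHomogeneous_X K j).C_mul _).sub ((isHomogeneous_X K i).C_mul _)
    have h1 := (hx 1 _ hG).mp ((hy 1 _ hG).mpr (by simp [mul_comm]))
    simp only [map_sub, map_mul, eval_C, eval_X, sub_eq_zero] at h1
    rw [Pi.smul_apply, smul_eq_mul, div_mul_eq_mul_div, eq_div_iff hi, mul_comm, h1, mul_comm]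
  refine ⟨v i / w i, fun h0 => hv ?_, h⟩
  rw [h, h0, zero_smul]

/-- The prime of `x` contains `F`, hence an irreducible factor `p` of `F`; so `x` lies on the
component with generic point `y`. -/
theorem exists_generization (hF0 : F ≠ 0) (x : curve hF) :
    ∃ p, Irreducible p ∧ p ∣ F ∧ ∃ y : curve hF,
      (∀ G, Ideal.Quotient.mk (Ideal.span {F}) G ∈ idealOf hF y ↔ p ∣ G) ∧ y ⤳ x := by
  obtain ⟨s, hs, hsF⟩ := WfDvdMonoid.exists_factors F hF0
  have hFx : F ∈ (idealOf hF x).comap (Ideal.Quotient.mk (Ideal.span {F})) := by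
    rw [Ideal.mem_comap, Ideal.Quotient.eq_zero_iff_mem.mpr (Ideal.mem_span_singleton_self F)]
    exact zero_mem _
  have hsx := Ideal.mem_of_dvd _ hsF.symm.dvd hFx
  rw [Ideal.IsPrime.multiset_prod_mem_iff_exists_mem inferInstance] at hsx
  obtain ⟨p, hps, hpx⟩ := hsx
  have hpF := (Multiset.dvd_prod hps).trans hsF.dvd
  obtain ⟨y, hy⟩ := exists_genericPoint hF (hs p hps) hpF hF0
  refine ⟨p, hs p hps, hpF, y, hy, (specializes_iff hF).mpr fun n G _ hG => ?_⟩
  exact Ideal.mem_of_dvd _ (map_dvd _ ((hy G).mp hG)) hpx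

theorem specializes_of_eval_eq_zero {p : MvPolynomial (Fin 3) K} {x y : curve hF} {v : Fin 3 → K}
    (hy : ∀ G, Ideal.Quotient.mk (Ideal.span {F}) G ∈ idealOf hF y ↔ p ∣ G)
    (hx : IsPointAt hF x v) (hpv : eval v p = 0) : y ⤳ x := by
  refine (specializes_iff hF).mpr fun n G hn hG => ((isPointAt_iff hF).mp hx n G hn).mpr ?_
  obtain ⟨q, rfl⟩ := (hy G).mp hG
  rw [map_mul, hpv, zero_mul]

/-- Otherwise `p` would divide, and so be proportional to, two independent linear forms vanishing at
`v`. -/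
theorem not_isPointAt_of_irreducible {p : MvPolynomial (Fin 3) K} (hp : Irreducible p)
    {y : curve hF} (hy : ∀ G, Ideal.Quotient.mk (Ideal.span {F}) G ∈ idealOf hF y ↔ p ∣ G)
    {v : Fin 3 → K} (hv : v ≠ 0) : ¬ IsPointAt hF y v := by
  intro hyv
  rw [isPointAt_iff] at hyv
  obtain ⟨i, hi⟩ := Function.ne_iff.mp hv
  have hi' : v i ≠ 0 := hi
  have key : ∀ j, j ≠ i → ∃ c, C (v i) * X j - C (v j) * X i = p * C c := by
    intro j hj
    have hG : (C (v i) * X j - C (v j) * X i : MvPolynomial (Fin 3) K).IsHomogeneous 1 :=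
      ((isHomogeneous_X K j).C_mul _).sub ((isHomogeneous_X K i).C_mul _)
    have h0 : (C (v i) * X j - C (v j) * X i : MvPolynomial (Fin 3) K) ≠ 0 := fun h => by
      have := congrArg (eval (Pi.single j 1)) h
      simp [hi', hj.symm] at this
    obtain ⟨q, hq⟩ := (hy _).mp ((hyv 1 _ hG).mpr (by simp [mul_comm]))
    have hq0 : q ≠ 0 := fun h => h0 (by rw [hq, h, mul_zero])
    have hdeg := totalDegree_mul_of_isDomain hp.ne_zero hq0
    rw [← hq, hG.totalDegree h0] at hdeg
    have := totalDegree_pos_of_not_isUnit hp.not_isUnit hp.ne_zero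
    exact ⟨coeff 0 q, by
      rw [hq, ← totalDegree_eq_zero_iff_eq_C.mp (by omega : q.totalDegree = 0)]⟩
  have h1 : i + 1 ≠ i := by fin_cases i <;> decide
  have h2 : i + 2 ≠ i := by fin_cases i <;> decide
  have h3 : i + 1 ≠ i + 2 := by fin_cases i <;> decide
  obtain ⟨c, hc⟩ := key _ h1
  obtain ⟨d, hd⟩ := key _ h2
  have h : (C (v i) * X (i + 1) - C (v (i + 1)) * X i) * C d =
      (C (v i) * X (i + 2) - C (v (i + 2)) * X i) * C c := by rw [hc, hd]; ring
  have e1 := congrArg (eval (Pi.single (i + 1) 1)) h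
  simp [hi', h1.symm, h3.symm] at e1
  have e2 := congrArg (eval (Pi.single (i + 2) 1)) hd
  simp [hi', h2.symm, e1] at e2

/-- The product `p q` divides `F`, and the product rule kills the partial derivatives where both
vanish. -/
theorem isSingularAt_of_not_associated {p q : MvPolynomial (Fin 3) K} (hp : Irreducible p)
    (hq : Irreducible q) (hpq : ¬ Associated p q) (hpF : p ∣ F) (hqF : q ∣ F) {v : Fin 3 → K}
    (hv : v ≠ 0) (hpv : eval v p = 0) (hqv : eval v q = 0) : IsSingularAt F v := by
  have hrel : IsRelPrime p q :=
    hp.isRelPrime_iff_not_dvd.mpr fun h => hpq (hp.associated_of_dvd hq h)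
  obtain ⟨r, rfl⟩ := hrel.mul_dvd hpF hqF
  exact ⟨hv, by simp [hpv], fun i => by simp [Derivation.leibniz, hpv, hqv]⟩

end Points

/-! ### Connectedness of the two normalizations -/

section Geometric

variable {k : Type u} [Field k] {F : MvPolynomial (Fin 3) k} {f : ℕ}

theorem IsSingularAt.map {R S : Type*} [Field R] [Field S] (φ : R →+* S)
    {G : MvPolynomial (Fin 3) R} {v : Fin 3 → R} (h : IsSingularAt G v) :
    IsSingularAt (MvPolynomial.map φ G) fun i => φ (v i) := by
  refine ⟨fun h0 => h.1 ?_, by rw [eval_map_comp, h.2.1, map_zero], fun i => ?_⟩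
  · ext i
    exact (map_eq_zero φ).mp (congrFun h0 i)
  · rw [pderiv_map, eval_map_comp, h.2.2 i, map_zero]

/-- If `V(F)` has a factorization over the algebraic closure as in
`exists_balanced_factorization`, then its total delta invariant is too large. -/
theorem false_of_factorization (hF : F.IsHomogeneous f) (hirr : Irreducible F)
    {S : Set (geomCurve hF)} {g : ℕ}
    (hg : (g : ℕ∞) + SchemeNormalization.totalDelta _ S = ((f - 1).choose 2 : ℕ))
    (hfg : CaseOfInterest f g) {D E : MvPolynomial (Fin 3) (AlgebraicClosure k)} {a b n e : ℕ}
    (hDE : geom F = D * E) (hD : D.IsHomogeneous a) (hE : E.IsHomogeneous b)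
    (hrel : IsRelPrime D E)
    (hS : ∀ v ≠ 0, eval v D = 0 → eval v E = 0 → ∃ x ∈ S, IsPointAt (hF.map _) x v)
    (hn : 2 ≤ n) (hen : e * n = f) (ha : a = e * (n / 2)) (hab : a + b = f) : False := by
  have hf := degree_ne_zero_of_irreducible hF hirr
  have ha0 : a ≠ 0 := by
    rw [ha]
    refine mul_ne_zero (fun h => hf ?_) (by omega)
    rw [← hen, h, zero_mul]
  have h1 := mul_le_totalDelta (hF.map _) hDE (geom_ne_zero hirr.ne_zero) hD hE ha0 hrel S hS
  have h2 : ((g + a * b : ℕ) : ℕ∞) ≤ ((f - 1).choose 2 : ℕ) := by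
    rw [← hg, Nat.cast_add]
    exact add_le_add_right h1 _
  exact (hfg.choose_lt hn hen ha hab hf).not_ge (by exact_mod_cast h2)

theorem exists_component (hF : F.IsHomogeneous f) (hirr : Irreducible F) :
    ∃ p, Irreducible p ∧ p ∣ geom F ∧ ∃ y : geomCurve hF,
      ∀ G, Ideal.Quotient.mk (Ideal.span {geom F}) G ∈ idealOf (hF.map _) y ↔ p ∣ G := by
  have hF0 := geom_ne_zero hirr.ne_zero
  have hunit : ¬ IsUnit (geom F) := fun h => by
    obtain ⟨c, -, hc⟩ := isUnit_iff_eq_C_of_isReduced.mp h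
    have h1 := (hF.map (algebraMap k (AlgebraicClosure k))).totalDegree hF0
    rw [show MvPolynomial.map (algebraMap k (AlgebraicClosure k)) F = C c from hc,
      totalDegree_C] at h1
    exact degree_ne_zero_of_irreducible hF hirr h1.symm
  obtain ⟨p, hp, hpF⟩ := WfDvdMonoid.exists_irreducible_factor hunit hF0
  exact ⟨p, hp, hpF, exists_genericPoint (hF.map _) hp hpF hF0⟩

theorem connectedSpace_normalization (hF : F.IsHomogeneous f) (hirr : Irreducible F) {g : ℕ}
    (hg : (g : ℕ∞) + SchemeNormalization.totalDelta _ (singularPoints hF) =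
      ((f - 1).choose 2 : ℕ))
    (hfg : CaseOfInterest f g) :
    ConnectedSpace (SchemeNormalization.normalization (geomCurve hF)) := by
  have hF0 := geom_ne_zero hirr.ne_zero
  rcases exists_balanced_factorization hF hirr {v | IsSingularAt (geom F) v} (by
      intro τ v hv
      have := hv.map (τ : AlgebraicClosure k →+* AlgebraicClosure k)
      rwa [map_geom] at this) with
    ⟨D, E, a, b, n, e, hDE, hD, hE, hrel, hZ, hn, hen, ha, hab⟩ | hall
  · refine (false_of_factorization hF hirr hg hfg hDE hD hE hrel ?_ hn hen ha hab).elim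
    intro v hv hDv hEv
    have hsing : IsSingularAt (geom F) v := hZ v hv hDv hEv
    obtain ⟨x, hx⟩ := exists_isPointAt (hF.map _) hv hsing.2.1
    exact ⟨x, ⟨v, hsing, hx⟩, hx⟩
  have hassoc : ∀ p q, Irreducible p → Irreducible q → p ∣ geom F → q ∣ geom F →
      Associated p q := by
    intro p q hp hq hpF hqF
    -- The property propagated along links is being associated to `p`: non-associated factors meet
    -- only in singular points, so they are never directly linked.
    refine hall (Associated p) (fun r s hr hs hrF hsF h hpr => hpr.trans ?_) p q hp hq hpF hqF
      (Associated.refl p)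
    rcases h with h | ⟨v, hv, hvZ, hrv, hsv⟩
    · exact h
    · by_contra hrs
      exact hvZ (isSingularAt_of_not_associated hr hs hrs hrF hsF hv hrv hsv)
  obtain ⟨p, hp, hpF, y, hy⟩ := exists_component hF hirr
  have hyx : ∀ x : geomCurve hF, y ⤳ x := by
    intro x
    obtain ⟨q, hq, hqF, z, hz, hzx⟩ := exists_generization (hF.map _) hF0 x
    refine Specializes.trans ?_ hzx
    refine (specializes_iff _).mpr fun n G _ hG => (hz G).mpr ?_
    exact (hassoc p q hp hq hpF hqF).symm.dvd.trans ((hy G).mp hG)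
  have huniv : closure {y} = (Set.univ : Set (geomCurve hF)) :=
    Set.eq_univ_of_forall fun x => specializes_iff_mem_closure.mp (hyx x)
  have : IrreducibleSpace (geomCurve hF) :=
    { isPreirreducible_univ := huniv ▸ isPreirreducible_singleton.closure
      toNonempty := ⟨y⟩ }
  have := SchemeNormalization.connectedSpace_genericScheme (geomCurve hF)
  exact SchemeNormalization.connectedSpace_normalization_of_connectedSpace _

theorem connectedSpace_partialNormalization (hF : F.IsHomogeneous f) (hirr : Irreducible F) {g : ℕ}
    (hg : (g : ℕ∞) + SchemeNormalization.totalDelta _ (rationalSingularPoints hF) =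
      ((f - 1).choose 2 : ℕ))
    (hfg : CaseOfInterest f g) :
    ConnectedSpace (SchemeNormalization.partialNormalization (geomCurve hF)
      (rationalSingularPoints hF)) := by
  have hF0 := geom_ne_zero hirr.ne_zero
  have hmapne : ∀ {w : Fin 3 → k}, IsSingularAt F w →
      (fun i => algebraMap k (AlgebraicClosure k) (w i)) ≠ 0 := fun hw =>
    (hw.map (algebraMap k (AlgebraicClosure k))).1
  rcases exists_balanced_factorization hF hirr
    -- Each `k`-singularity enters with all its multiples over the closure, so membership depends
    -- only on the point. An automorphism moves only the scalar `c`.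
    {v | ∃ c : AlgebraicClosure k, c ≠ 0 ∧ ∃ w : Fin 3 → k, IsSingularAt F w ∧
      v = c • fun i => algebraMap k (AlgebraicClosure k) (w i)} (by
      rintro τ _ ⟨c, hc, w, hw, rfl⟩
      refine ⟨τ c, (map_ne_zero_iff τ τ.injective).mpr hc, w, hw, ?_⟩
      ext i
      simp) with
    ⟨D, E, a, b, n, e, hDE, hD, hE, hrel, hZ, hn, hen, ha, hab⟩ | hall
  · refine (false_of_factorization hF hirr hg hfg hDE hD hE hrel ?_ hn hen ha hab).elim
    intro v hv hDv hEv
    obtain ⟨x, hx⟩ := exists_isPointAt (hF.map _) hv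
      (show eval v (geom F) = 0 by rw [hDE, map_mul, hDv, zero_mul])
    obtain ⟨c, hc, w, hw, rfl⟩ := hZ v hv hDv hEv
    exact ⟨x, ⟨w, hw, hx.of_smul _ hc⟩, hx⟩
  have hgen : ∀ {p} {y : geomCurve hF}, Irreducible p →
      (∀ G, Ideal.Quotient.mk (Ideal.span {geom F}) G ∈ idealOf (hF.map _) y ↔ p ∣ G) →
      y ∉ rationalSingularPoints hF := by
    rintro p y hp hy ⟨w, hw, hyw⟩
    exact not_isPointAt_of_irreducible _ hp hy (hmapne hw) hyw
  have hpre : IsPreconnected (rationalSingularPoints hF)ᶜ := by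
    rw [isPreconnected_iff_subset_of_disjoint]
    intro U V hU hV hUV hdisj
    by_contra! hcon
    obtain ⟨x, hx, hxU⟩ := Set.not_subset.mp hcon.1
    obtain ⟨y, hy, hyV⟩ := Set.not_subset.mp hcon.2
    obtain ⟨p, hp, hpF, ξ, hξ, hξx⟩ := exists_generization (hF.map _) hF0 x
    obtain ⟨q, hq, hqF, η, hη, hηy⟩ := exists_generization (hF.map _) hF0 y
    have hdisj' : ∀ z, z ∉ rationalSingularPoints hF → z ∈ U → z ∉ V := fun z hz hzU hzV => by
      have : z ∈ (rationalSingularPoints hF)ᶜ ∩ (U ∩ V) := ⟨hz, hzU, hzV⟩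
      rwa [hdisj] at this
    have hξV : ξ ∈ V := hξx.mem_open hV ((hUV hx).resolve_left hxU)
    have hηU : η ∈ U := hηy.mem_open hU ((hUV hy).resolve_right hyV)
    -- The property propagated along links is that the generic point of the component lies in `U`.
    -- Linked components meet outside the `k`-singularities, at a point of `U` or `V`; open sets
    -- contain generizations, so `V` would put the first generic point in both sets, and `U`
    -- receives the second one.
    have hW := hall (fun p => ∀ ξ : geomCurve hF,
      (∀ G, Ideal.Quotient.mk (Ideal.span {geom F}) G ∈ idealOf (hF.map _) ξ ↔ p ∣ G) → ξ ∈ U) (by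
        intro p q hp hq hpF hqF h hWp ξ hξ
        rcases h with h | ⟨v, hv, hvZ, hpv, hqv⟩
        · exact hWp ξ fun G => (hξ G).trans h.dvd_iff_dvd_left.symm
        · obtain ⟨x, hx⟩ := exists_isPointAt (hF.map _) hv (show eval v (geom F) = 0 by
            obtain ⟨r, hr⟩ := hpF
            rw [hr, map_mul, hpv, zero_mul])
          obtain ⟨ζ, hζ⟩ := exists_genericPoint (hF.map _) hp hpF hF0
          have hxS : x ∉ rationalSingularPoints hF := by
            rintro ⟨w, hw, hxw⟩
            obtain ⟨c, hc, hvw⟩ := hx.exists_eq_smul _ hv (hmapne hw) hxw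
            exact hvZ ⟨c, hc, w, hw, hvw⟩
          refine (specializes_of_eval_eq_zero _ hξ hx hqv).mem_open hU ?_
          refine (hUV hxS).resolve_right fun hxV => ?_
          exact hdisj' ζ (hgen hp hζ) (hWp ζ hζ)
            ((specializes_of_eval_eq_zero _ hζ hx hpv).mem_open hV hxV))
      q p hq hp hqF hpF (fun ζ hζ => by
        rwa [curve_ext (hF.map _) fun n G _ => (hζ G).trans (hη G).symm])
    exact hdisj' ξ (hgen hp hξ) (hW ξ hξ) hξV
  obtain ⟨p, hp, -, ξ, hξ⟩ := exists_component hF hirr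
  have hconn : _root_.IsConnected
      (SchemeNormalization.complOpen (geomCurve hF) (rationalSingularPoints hF) :
        Set (geomCurve hF)) := by
    have h : (SchemeNormalization.complOpen (geomCurve hF) (rationalSingularPoints hF) :
        Set (geomCurve hF)) = (rationalSingularPoints hF)ᶜ :=
      congrArg compl (closure_rationalSingularPoints hF hirr)
    rw [h]
    exact ⟨⟨ξ, hgen hp hξ⟩, hpre⟩
  have : ConnectedSpace (SchemeNormalization.complOpen (geomCurve hF)
      (rationalSingularPoints hF) : Scheme) := isConnected_iff_connectedSpace.mp hconn
  exact SchemeNormalization.connectedSpace_normalization_of_connectedSpace _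

end Geometric

end PlaneCurve

theorem corollaryC {k : Type*} [Field k] {F : MvPolynomial (Fin 3) k} {f : ℕ}
    (hF : F.IsHomogeneous f) (hirr : Irreducible F) :
    (∀ g : ℕ,
      (g : ℕ∞) + SchemeNormalization.totalDelta _ (PlaneCurve.singularPoints hF)
        = ((f - 1).choose 2 : ℕ) →
      PlaneCurve.CaseOfInterest f g →
      PlaneCurve.HasOnlyAdmissibleSingularities F →
      ConnectedSpace (SchemeNormalization.normalization (PlaneCurve.geomCurve hF))) ∧
    (∀ g : ℕ,
      (g : ℕ∞) + SchemeNormalization.totalDelta _ (PlaneCurve.rationalSingularPoints hF)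
        = ((f - 1).choose 2 : ℕ) →
      PlaneCurve.CaseOfInterest f g →
      PlaneCurve.HasAdmissibleRationalSingularities F →
      ConnectedSpace (SchemeNormalization.partialNormalization (PlaneCurve.geomCurve hF)
        (PlaneCurve.rationalSingularPoints hF))) :=
  ⟨fun _ hg hfg _ => PlaneCurve.connectedSpace_normalization hF hirr hg hfg,
    fun _ hg hfg _ => PlaneCurve.connectedSpace_partialNormalization hF hirr hg hfg⟩
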